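/- Let $\mathbb F$ be an algebraically closed field of any characteristic, let $E$ be a smooth projective connected curve of genus $1$ over $\mathbb F$, and let $p \neq q$ be two points of $E$. Let $m$ be the order of $p-q$ in the Jacobian of $E$, with $m = 0$ if $p-q$ is not torsion. Let $r \ge 0$, and let $\alpha = (\alpha_0 \le \dots \le \alpha_r)$ and $\beta = (\beta_0 \le \dots \le \beta_r)$ be nondecreasing sequences of integers with $\alpha \le \beta$ (that is, $\alpha_i \le \beta_i$ for all $i$); write $\alpha<\beta$ if moreover $\alpha\ne\beta$. A rational linear series of rank $r$ and degree $d$ on $(E,p,q)$ is a pair $(\mathcal L, V)$ of a line bundle $\mathcal L$ of degree $d$ and an $(r+1)$-dimensional subspace $V \subseteq H^0(E \setminus \{p,q\}, \mathcal L)$. Its ramification sequence at a point $x\in\{p,q\}$ is $(a_0, a_1 - 1, \dots, a_r - r)$, where $a_0 < \dots < a_r$ are the orders of vanishing at $x$ (negative at a pole) of the nonzero elements of $V$. Let $\widetilde G^{\beta/\alpha}(E,p,q)$ be the space of isomorphism classes of rational linear series of rank $r$ and degree $r+1$ with ramification sequence exactly $(-\alpha_r, \dots, -\alpha_0)$ at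 $p$ and exactly $\beta$ at $q$, with its Zariski topology. An arithmetic progression of modulus $m$ (where $m=0$ or $m\ge 2$) is a set $\Lambda = n + m\mathbb Z$ with $n \in \mathbb Z$. Call an entry $\alpha_i$ increasable (decreasable) if $\alpha$ stays nondecreasing after $\alpha_i$ is increased (decreased) by $1$. Let $\operatorname{disp}^+_\Lambda(\alpha)$ be obtained from $\alpha$ by adding $1$ to each increasable entry $\alpha_i$ with $\alpha_i + i + 1 \in \Lambda$, and $\operatorname{disp}^-_\Lambda(\alpha)$ by subtracting $1$ from each decreasable entry $\alpha_i$ with $\alpha_i + i \in \Lambda$. The sequences $\alpha\le\beta$ are linked by $\Lambda$ if $\alpha = \operatorname{disp}^-_\Lambda(\beta)$ and $\beta = \operatorname{disp}^+_\Lambda(\alpha)$. Then: 1. If $\alpha = \beta$, then $\widetilde G^{\beta/\alpha}(E,p,q)$ is $1$-dimensional. 2. If $\alpha < \beta$, then $\widetilde G^{\beta/\alpha}(E,p,q)$ has a single point if $\alpha, \beta$ are linked by an arithmetic progression of modulus $m$, and it is empty otherwise. -/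

import Mathlib

open scoped WithZero

namespace TwiceMarked

noncomputable section

/-! ### Smooth projective curves over an algebraically closed field

A smooth projective (connected) curve over an algebraically closed field `F` is given by its
function field `K`, a finitely generated extension of `F` of transcendence degree one. Its closed
points are the discrete valuations of `K` that are trivial on `F`. -/

section Curve

variable (F K : Type*) [Field F] [Field K] [Algebra F K]

/-- `K` is the function field of a smooth projective curve over `F`. -/
structure IsCurve : Prop where
  fg : (⊤ : IntermediateField F K).FG
  trdeg_eq_one : Algebra.trdeg F K = 1

/-- The closed points of the smooth projective curve with function field `K`: the normalized
discrete valuations of `K` trivial on `F`, written multiplicatively, so that a nonzero `f` with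
`v f = exp (-n)` vanishes to order `n` at the point. -/
@[ext]
structure Point where
  v : Valuation K ℤᵐ⁰
  surjective : Function.Surjective v
  trivial : ∀ c : F, c ≠ 0 → v (algebraMap F K c) = 1

/-- Divisors on the curve. -/
abbrev Divisor := Point F K →₀ ℤ

variable {F K}

/-- The order of vanishing of a nonzero rational function `f` at a point. -/
def Point.ord (x : Point F K) (f : K) : ℤ := -WithZero.log (x.v f)

/-- The degree of a divisor (every closed point has degree one, as `F` is algebraically
closed). -/
def Divisor.degree (D : Divisor F K) : ℤ := D.sum fun _ n => n

/-- The rational sections of the line bundle `O(D)` that are regular on the set `U` of points: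
those `f` with `f = 0` or `ord_x f + D x ≥ 0` for all `x ∈ U`. -/
def sectionsOn (U : Set (Point F K)) (D : Divisor F K) : Submodule F K where
  carrier := {f | ∀ x ∈ U, x.v f ≤ WithZero.exp (D x)}
  add_mem' := fun ha hb x hx => x.v.map_add_le (ha x hx) (hb x hx)
  zero_mem' := fun x _ => by simp
  smul_mem' := fun c f hf x hx => by
    rw [Algebra.smul_def, map_mul]
    by_cases hc : c = 0
    · simp [hc]
    · rw [x.trivial c hc, one_mul]
      exact hf x hx

variable (F K) in
/-- The curve has genus `g`, by Riemann's definition: `g` is the maximum of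
`deg D + 1 - h⁰(O(D))` over all divisors `D`. -/
def HasGenus (g : ℤ) : Prop :=
  IsGreatest (Set.range fun D : Divisor F K =>
    D.degree + 1 - (Module.finrank F (sectionsOn Set.univ D) : ℤ)) g

/-- `D` is the divisor of the nonzero rational function `f`. -/
def IsDivisorOf (D : Divisor F K) (f : K) : Prop := f ≠ 0 ∧ ∀ x, D x = x.ord f

theorem Point.ord_mul (x : Point F K) {f g : K} (hf : f ≠ 0) (hg : g ≠ 0) :
    x.ord (f * g) = x.ord f + x.ord g := by
  have h1 : x.v f ≠ 0 := (Valuation.ne_zero_iff _).2 hf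
  have h2 : x.v g ≠ 0 := (Valuation.ne_zero_iff _).2 hg
  simp only [Point.ord, map_mul, WithZero.log_mul h1 h2]
  ring

theorem Point.ord_one (x : Point F K) : x.ord (1 : K) = 0 := by simp [Point.ord]

theorem Point.ord_inv (x : Point F K) (f : K) : x.ord f⁻¹ = -x.ord f := by
  simp [Point.ord, WithZero.log_inv]

variable (F K) in
/-- The group of principal divisors. -/
def principalDivisors : AddSubgroup (Divisor F K) where
  carrier := {D | ∃ f : K, IsDivisorOf D f}
  zero_mem' := ⟨1, one_ne_zero, fun x => by simp [Point.ord_one]⟩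
  add_mem' := by
    rintro D D' ⟨f, hf, h⟩ ⟨g, hg, h'⟩
    exact ⟨f * g, mul_ne_zero hf hg, fun x => by
      rw [Finsupp.add_apply, h, h', x.ord_mul hf hg]⟩
  neg_mem' := by
    rintro D ⟨f, hf, h⟩
    exact ⟨f⁻¹, inv_ne_zero hf, fun x => by rw [Finsupp.neg_apply, h, x.ord_inv]⟩

variable (F K) in
/-- The Picard group: divisors modulo principal divisors. The Jacobian is its subgroup of
classes of degree zero. -/
abbrev Pic := Divisor F K ⧸ principalDivisors F K

/-- The order of `p - q` in the Jacobian, and `0` if `p - q` is not torsion. -/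
def torsionOrder (p q : Point F K) : ℕ :=
  addOrderOf (QuotientAddGroup.mk (Finsupp.single p 1 - Finsupp.single q 1) : Pic F K)

end Curve

/-! ### Ramification sequences and displacement -/

section Displacement

variable {r : ℕ}

/-- `n - α` for `n = 0`, that is, `(-α_r, …, -α_0)`. -/
def negSeq (α : Fin (r + 1) → ℤ) : Fin (r + 1) → ℤ := fun i => -α i.rev

/-- `Λ` is an arithmetic progression of modulus `m`, that is, `Λ = n + m ℤ` for some `n`, where
`m = 0` or `m ≥ 2`. -/
def IsProgression (m : ℕ) (Λ : Set ℤ) : Prop :=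
  (m = 0 ∨ 2 ≤ m) ∧ ∃ n : ℤ, Λ = {k | ∃ j : ℤ, k = n + m * j}

/-- `α_i` is increasable: increasing it by one leaves the sequence nondecreasing. -/
def Increasable (α : Fin (r + 1) → ℤ) (i : Fin (r + 1)) : Prop :=
  Monotone (Function.update α i (α i + 1))

/-- `α_i` is decreasable: decreasing it by one leaves the sequence nondecreasing. -/
def Decreasable (α : Fin (r + 1) → ℤ) (i : Fin (r + 1)) : Prop :=
  Monotone (Function.update α i (α i - 1))

open Classical in
/-- Upward displacement along `Λ`. -/
def dispUp (Λ : Set ℤ) (α : Fin (r + 1) → ℤ) : Fin (r + 1) → ℤ := fun i =>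
  if Increasable α i ∧ α i + (i : ℕ) + 1 ∈ Λ then α i + 1 else α i

open Classical in
/-- Downward displacement along `Λ`. -/
def dispDown (Λ : Set ℤ) (α : Fin (r + 1) → ℤ) : Fin (r + 1) → ℤ := fun i =>
  if Decreasable α i ∧ α i + (i : ℕ) ∈ Λ then α i - 1 else α i

/-- `α ≤ β` are linked by `Λ`. -/
def Linked (Λ : Set ℤ) (α β : Fin (r + 1) → ℤ) : Prop :=
  α ≤ β ∧ α = dispDown Λ β ∧ β = dispUp Λ α

end Displacement

/-! ### Rational linear series on a twice-marked curve -/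

section Series

variable {F K : Type*} [Field F] [Field K] [Algebra F K]

/-- The set of vanishing orders at `x` of the nonzero sections in `V` of the line bundle `O(D)`
(negative at a pole). -/
def vanishingOrders (D : Divisor F K) (V : Submodule F K) (x : Point F K) : Set ℤ :=
  {n | ∃ s ∈ V, s ≠ 0 ∧ n = x.ord s + D x}

/-- The ramification sequence at `x` of the space `V` of sections of `O(D)` is `γ`: the strictly
increasing sequence of the vanishing orders is `γ_i + i`. -/
def HasRamification {r : ℕ} (D : Divisor F K) (V : Submodule F K) (x : Point F K)
    (γ : Fin (r + 1) → ℤ) : Prop :=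
  StrictMono (fun i : Fin (r + 1) => γ i + (i : ℕ)) ∧
    Set.range (fun i : Fin (r + 1) => γ i + (i : ℕ)) = vanishingOrders D V x

/-- The pair `(O(D), V)` is a rational linear series of rank `r` and degree `d` on the curve
marked at `p` and `q`. -/
structure IsRationalSeries (p q : Point F K) (r : ℕ) (d : ℤ) (D : Divisor F K)
    (V : Submodule F K) : Prop where
  degree_eq : D.degree = d
  finrank_eq : Module.finrank F V = r + 1
  regular : V ≤ sectionsOn {p, q}ᶜ D

variable {r : ℕ}

/-- `(O(D), V)` is a rational linear series of rank `r` and degree `r + g` (with genus `g = 1`)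
with ramification exactly `-α` at `p` and exactly `β` at `q`. -/
structure IsExactSeries (p q : Point F K) (α β : Fin (r + 1) → ℤ) (D : Divisor F K)
    (V : Submodule F K) : Prop extends IsRationalSeries p q r (r + 1) D V where
  ram_p : HasRamification D V p (negSeq α)
  ram_q : HasRamification D V q β

/-- Pairs `(D, V)` such that `(O(D), V)` is a rational linear series of degree `r + 1` with
ramification exactly `-α` at `p` and `β` at `q`. -/
def ExactSeries (p q : Point F K) (α β : Fin (r + 1) → ℤ) : Type _ :=
  {L : Divisor F K × Submodule F K // IsExactSeries p q α β L.1 L.2}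

/-- `(O(D), V)` and `(O(D'), V')` are isomorphic: multiplication by a nonzero rational function
`f` with `div f = D - D'` is an isomorphism `O(D) → O(D')`, and it takes `V` to `V'`. -/
def SeriesIso (L L' : Divisor F K × Submodule F K) : Prop :=
  ∃ f : K, IsDivisorOf (L.1 - L'.1) f ∧ L'.2 = L.2.map (LinearMap.mulLeft F f)

theorem SeriesIso.equivalence : Equivalence (SeriesIso (F := F) (K := K)) where
  refl L := ⟨1, ⟨one_ne_zero, fun x => by simp [Point.ord_one]⟩, by
    ext; simp⟩
  symm := by
    rintro ⟨D, V⟩ ⟨D', V'⟩ ⟨f, ⟨hf, h⟩, rfl⟩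
    refine ⟨f⁻¹, ⟨inv_ne_zero hf, fun x => ?_⟩, ?_⟩
    · have := h x
      simp only [Finsupp.sub_apply] at this ⊢
      rw [x.ord_inv, ← this]
      ring
    · ext s
      simp [Submodule.mem_map, hf]
  trans := by
    rintro ⟨D, V⟩ ⟨D', V'⟩ ⟨D'', V''⟩ ⟨f, ⟨hf, h⟩, rfl⟩ ⟨g, ⟨hg, h'⟩, rfl⟩
    refine ⟨g * f, ⟨mul_ne_zero hg hf, fun x => ?_⟩, ?_⟩
    · have h1 := h x
      have h2 := h' x
      simp only [Finsupp.sub_apply] at h1 h2 ⊢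
      rw [x.ord_mul hg hf, ← h1, ← h2]
      ring
    · ext s
      simp [Submodule.mem_map]

instance seriesSetoid (p q : Point F K) (α β : Fin (r + 1) → ℤ) :
    Setoid (ExactSeries p q α β) :=
  (Setoid.mk SeriesIso SeriesIso.equivalence).comap Subtype.val

/-- The points of the space of rational linear series of degree `r + 1` on the genus one curve
marked at `p` and `q` with ramification exactly `-α` at `p` and exactly `β` at `q`. -/
def GTilde (p q : Point F K) (α β : Fin (r + 1) → ℤ) : Type _ :=
  Quotient (seriesSetoid p q α β)

/-! ### The Zariski topology -/

/-- The value at the point `(x, v)` of the product of the curve with `K ^ (r + 1)` of the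
polynomial `P` over `K` in the coordinates `ℓ (v i)`, with `ℓ` an `F`-linear form on `K`: the
coordinates are elements of `F`, hence constant functions in `K`, so that this is a rational
function on the curve; its reduction at `x` is the value. -/
def evalAt (P : MvPolynomial (Fin (r + 1) × Module.Dual F K) K) (v : Fin (r + 1) → K) : K :=
  MvPolynomial.eval (fun j => algebraMap F K (j.2 (v j.1))) P

/-- The Zariski topology on the closed points of the product of the curve with the `F`-vector
space `K ^ (r + 1)`. The basic open sets are `{P ≠ 0}` inside the locus where the coefficients of
`P` are regular functions on the curve. On the product of the curve with `W ^ (r + 1)`, for a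
finite-dimensional `W ⊆ K`, this induces the usual Zariski topology of the product variety. -/
@[reducible] def zariski (F K : Type*) [Field F] [Field K] [Algebra F K] (r : ℕ) :
    TopologicalSpace (Point F K × (Fin (r + 1) → K)) :=
  TopologicalSpace.generateFrom
    (Set.range fun P : MvPolynomial (Fin (r + 1) × Module.Dual F K) K =>
      {z | (∀ c, z.1.v (P.coeff c) ≤ 1) ∧ z.1.v (evalAt P z.2) = 1})

/-- The framed series with line bundle of the form `O(M - x)`: pairs of a point `x` and a tuple
`v` such that `v` spans a space `V` for which `(O(M - x), V)` has the required ramification. -/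
def Frames (p q : Point F K) (α β : Fin (r + 1) → ℤ) (M : Divisor F K) : Type _ :=
  {z : Point F K × (Fin (r + 1) → K) //
    IsExactSeries p q α β (M - Finsupp.single z.1 1) (Submodule.span F (Set.range z.2))}

/-- The linear series of a framed series. -/
def Frames.toGTilde {p q : Point F K} {α β : Fin (r + 1) → ℤ} {M : Divisor F K}
    (z : Frames p q α β M) : GTilde p q α β :=
  Quotient.mk _ ⟨(M - Finsupp.single z.1.1 1, Submodule.span F (Set.range z.1.2)), z.2⟩

/-- The Zariski topology on the space of linear series on a curve of genus one. For a fixed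
divisor `M` of degree `r + 2`, every line bundle of degree `r + 1` is isomorphic to `O(M - x)` for
a unique point `x`, and all spaces `V` in question, for all `x`, lie in one finite-dimensional
space of sections of `O(M)` with bounded poles at `p` and `q`. So the space is the quotient of the
variety of framed series by `GL_{r+1}`, and it carries the quotient topology. (The topology does
not depend on `M`; to avoid a choice it is written as the final topology for all `M`.) -/
instance (p q : Point F K) (α β : Fin (r + 1) → ℤ) : TopologicalSpace (GTilde p q α β) :=
  ⨆ M : Divisor F K, TopologicalSpace.coinduced (Frames.toGTilde (M := M))
    (TopologicalSpace.induced Subtype.val (zariski F K r))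

end Series

end

end TwiceMarked

/-! The space `V` is determined by the line bundle `O(D)`, so everything reduces to deciding which
`D` of degree `r + 1` occur. In a series with the given ramification, intersecting the sections of
order at least `r - α j - j` at `p` with those of order at least `β i + i` at `q` leaves dimension
at least `j + 1 - i`. For `i = j` this is a nonzero section of a twist of `O(D)` of degree `1 + α i
- β i`. On a curve of genus one, Riemann-Roch gives `h⁰ = deg` in positive degree, `h⁰ = 0` in
negative degree, and `h⁰ ≠ 0` in degree zero only for the trivial bundle. Hence `β i ≤ α i + 1`, and
equality forces `α i + i + 1` into `markedClass D p q`, a set which is empty or an arithmetic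
progression of modulus the order of `p - q`. If `β i = α i`, the one section of the twist lies in
`V`; when it vanishes to higher order than required, that order must again occur in the
ramification, which forces a neighbouring equal entry. Together these conditions (`IsAdmissible`)
say that `α` and `β` are linked by `markedClass D p q` (`IsExactSeries.isAdmissible`,
`isAdmissible_iff_linked`). Conversely, under them a basis with exact orders at both points exists,
and the dimension bound puts it in every candidate `V` (`exists_unique_isExactSeries`). If `α < β`,
some `β i = α i + 1` prescribes an element of the marked class, hence the class of `D`: there is one
point or none. If `α = β`, every `D` whose marked class avoids finitely many integers is admissible.
Writing `D = M - x`, the space becomes a set of points `x` containing almost all of the curve.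
Pencils `f(x) g - g(x) f` give frames varying algebraically with `x`, so open sets meeting the
generic locus are cofinite and the dimension is one. -/

namespace TwiceMarked
noncomputable section

/-! ### Orders of vanishing and valuations at a point -/

section Orders

variable {F K : Type*} [Field F] [Field K] [Algebra F K]

theorem Point.v_eq_exp (x : Point F K) {f : K} (hf : f ≠ 0) :
    x.v f = WithZero.exp (-x.ord f) := by
  rw [Point.ord, neg_neg, WithZero.exp_log ((Valuation.ne_zero_iff _).2 hf)]

theorem Point.v_le_exp_iff (x : Point F K) {f : K} (hf : f ≠ 0) (n : ℤ) :
    x.v f ≤ WithZero.exp n ↔ 0 ≤ x.ord f + n := by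
  rw [x.v_eq_exp hf, WithZero.exp_le_exp]
  omega

theorem Point.v_le_one_iff (x : Point F K) {f : K} (hf : f ≠ 0) :
    x.v f ≤ 1 ↔ 0 ≤ x.ord f := by
  rw [← WithZero.exp_zero, x.v_le_exp_iff hf, add_zero]

theorem Point.v_lt_one_iff (x : Point F K) {f : K} (hf : f ≠ 0) :
    x.v f < 1 ↔ 0 < x.ord f := by
  rw [← WithZero.exp_zero, x.v_eq_exp hf, WithZero.exp_lt_exp]
  omega

theorem Point.v_algebraMap_le_one (x : Point F K) (c : F) : x.v (algebraMap F K c) ≤ 1 := by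
  by_cases hc : c = 0
  · simp [hc]
  · exact (x.trivial c hc).le

theorem Point.v_smul (x : Point F K) {c : F} (hc : c ≠ 0) (f : K) : x.v (c • f) = x.v f := by
  rw [Algebra.smul_def, map_mul, x.trivial c hc, one_mul]

theorem Point.ord_pow (x : Point F K) (f : K) (n : ℕ) : x.ord (f ^ n) = n * x.ord f := by
  simp [Point.ord, WithZero.log_pow]

theorem Point.v_sum_le (x : Point F K) {ι : Type*} (s : Finset ι) (c : ι → F) (t : ι → K)
    {g : ℤᵐ⁰} (h : ∀ i ∈ s, c i ≠ 0 → x.v (t i) ≤ g) : x.v (∑ i ∈ s, c i • t i) ≤ g := by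
  refine Valuation.map_sum_le _ fun i hi => ?_
  by_cases hc : c i = 0
  · simp [hc]
  · rw [x.v_smul hc]
    exact h i hi hc

/-- Functions with distinct orders at a point: a nontrivial combination has one of the orders. -/
theorem Point.exists_ord_sum_eq (x : Point F K) {ι : Type*} [Fintype ι] {t : ι → K}
    (ht : ∀ i, t i ≠ 0) (hinj : Function.Injective fun i => x.ord (t i)) {c : ι → F}
    (hc : c ≠ 0) : ∃ i, c i ≠ 0 ∧ ∑ i, c i • t i ≠ 0 ∧ x.ord (∑ i, c i • t i) = x.ord (t i) := by
  classical
  have hne : (Finset.univ.filter fun i => c i ≠ 0).Nonempty := by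
    obtain ⟨i, hi⟩ := Function.ne_iff.1 hc
    exact ⟨i, by simpa using hi⟩
  obtain ⟨i, hi, hmax⟩ := Finset.exists_min_image _ (fun i => x.ord (t i)) hne
  have hci : c i ≠ 0 := by simpa using hi
  have key : x.v (∑ j, c j • t j) = x.v (c i • t i) := by
    refine Valuation.map_sum_eq_of_lt (f := fun j => c j • t j) (v := x.v) (Finset.mem_univ i)
      fun j hj => ?_
    have hji : j ≠ i := by simpa using hj
    rw [x.v_smul hci]
    by_cases hcj : c j = 0
    · simp [hcj, zero_lt_iff, ht i]
    · rw [x.v_smul hcj, x.v_eq_exp (ht i), x.v_eq_exp (ht j), WithZero.exp_lt_exp, neg_lt_neg_iff]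
      exact lt_of_le_of_ne (hmax j (by simpa using hcj)) fun h => hji (hinj h.symm)
  refine ⟨i, hci, ?_, ?_⟩
  · rw [← Valuation.ne_zero_iff x.v, key, Valuation.ne_zero_iff]
    exact smul_ne_zero hci (ht i)
  · rw [Point.ord, key, x.v_smul hci, Point.ord]

theorem Point.linearIndependent_of_ord (x : Point F K) {ι : Type*} [Fintype ι] {t : ι → K}
    (ht : ∀ i, t i ≠ 0) (hinj : Function.Injective fun i => x.ord (t i)) :
    LinearIndependent F t := by
  rw [Fintype.linearIndependent_iff]
  intro c hc
  by_contra! h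
  obtain ⟨i, -, h0, -⟩ := x.exists_ord_sum_eq ht hinj (c := c) (Function.ne_iff.2 h)
  exact h0 hc

theorem exists_aeval_eq_of_mem_adjoin {f : K} (y : Algebra.adjoin F {f}) :
    ∃ P : Polynomial F, Polynomial.aeval f P = (y : K) := by
  obtain ⟨y, hy⟩ := y
  rw [Algebra.adjoin_singleton_eq_range_aeval] at hy
  exact hy

theorem Point.v_aeval_le_one (x : Point F K) {f : K} (hf : x.v f ≤ 1) (P : Polynomial F) :
    x.v (Polynomial.aeval f P) ≤ 1 := by
  rw [Polynomial.aeval_eq_sum_range]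
  refine x.v_sum_le _ _ _ fun i _ _ => ?_
  rw [map_pow]
  exact pow_le_one' hf i

/-- The valuation ring of `x` contains `F[f]` and is integrally closed. -/
theorem Point.v_le_one_of_isIntegral (x : Point F K) {f g : K} (hf : x.v f ≤ 1)
    (hg : IsIntegral (Algebra.adjoin F {f}) g) : x.v g ≤ 1 := by
  have hadj : ∀ z : Algebra.adjoin F {f}, x.v (z : K) ≤ 1 := fun z => by
    obtain ⟨P, hP⟩ := exists_aeval_eq_of_mem_adjoin z
    rw [← hP]
    exact x.v_aeval_le_one hf P
  let φ : Algebra.adjoin F {f} →+* x.v.integer :=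
    (Algebra.adjoin F {f}).val.toRingHom.codRestrict x.v.integer hadj
  have hint : IsIntegral x.v.integer g := hg.map_of_comp_eq φ (RingHom.id K) (by ext; rfl)
  exact (Valuation.integer.integers x.v).mem_of_integral hint

end Orders

/-! ### Degrees of divisors and global sections -/

section Degree

variable {F K : Type*} [Field F] [Field K] [Algebra F K]

theorem Divisor.degree_add (D E : Divisor F K) : (D + E).degree = D.degree + E.degree :=
  Finsupp.sum_add_index' (fun _ => rfl) fun _ _ _ => rfl

theorem Divisor.degree_single (x : Point F K) (n : ℤ) :
    Divisor.degree (Finsupp.single x n) = n := Finsupp.sum_single_index rfl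

theorem Divisor.degree_zero : (0 : Divisor F K).degree = 0 := Finsupp.sum_zero_index

theorem Divisor.degree_neg (D : Divisor F K) : (-D).degree = -D.degree := by
  have h := Divisor.degree_add D (-D)
  rw [add_neg_cancel, Divisor.degree_zero] at h
  omega

theorem Divisor.degree_sub (D E : Divisor F K) : (D - E).degree = D.degree - E.degree := by
  rw [sub_eq_add_neg, Divisor.degree_add, Divisor.degree_neg]; ring

theorem Divisor.degree_nsmul (n : ℕ) (D : Divisor F K) : (n • D).degree = n * D.degree := by
  induction n with
  | zero => simp [Divisor.degree_zero]
  | succ n ih => rw [succ_nsmul, Divisor.degree_add, ih]; push_cast; ring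

/-- The global sections of `O(D)`. -/
abbrev H0 (D : Divisor F K) : Submodule F K := sectionsOn Set.univ D

theorem mem_H0 {D : Divisor F K} {f : K} : f ∈ H0 D ↔ ∀ x, x.v f ≤ WithZero.exp (D x) :=
  ⟨fun h x => h x trivial, fun h x _ => h x⟩

theorem mem_H0_iff_ord {D : Divisor F K} {f : K} (hf : f ≠ 0) :
    f ∈ H0 D ↔ ∀ x, 0 ≤ x.ord f + D x := by
  rw [mem_H0]
  exact forall_congr' fun x => x.v_le_exp_iff hf _

theorem mem_H0_zero {f : K} : f ∈ H0 (0 : Divisor F K) ↔ ∀ x : Point F K, x.v f ≤ 1 := by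
  simp [mem_H0]

theorem H0_mono {D E : Divisor F K} (h : D ≤ E) : H0 D ≤ H0 E := fun _ hf x hx =>
  (hf x hx).trans (WithZero.exp_le_exp.2 (h x))

theorem mul_mem_H0 {D E : Divisor F K} {f g : K} (hf : f ∈ H0 D) (hg : g ∈ H0 E) :
    f * g ∈ H0 (D + E) := fun x hx => by
  rw [map_mul, Finsupp.add_apply, WithZero.exp_add]
  exact mul_le_mul' (hf x hx) (hg x hx)

theorem one_mem_H0_zero : (1 : K) ∈ H0 (0 : Divisor F K) := mem_H0_zero.2 fun x => by simp

theorem pow_mem_H0 {D : Divisor F K} {f : K} (hf : f ∈ H0 D) (n : ℕ) : f ^ n ∈ H0 (n • D) := by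
  induction n with
  | zero => simpa using one_mem_H0_zero
  | succ n ih =>
    rw [pow_succ, succ_nsmul]
    exact mul_mem_H0 ih hf

theorem algebraMap_mem_H0_zero (c : F) : algebraMap F K c ∈ H0 (0 : Divisor F K) :=
  mem_H0_zero.2 fun x => x.v_algebraMap_le_one c

theorem mem_H0_sub_single {D : Divisor F K} {f : K} {x : Point F K} (hf : f ≠ 0) :
    f ∈ H0 (D - Finsupp.single x 1) ↔ f ∈ H0 D ∧ 1 ≤ x.ord f + D x := by
  classical
  rw [mem_H0_iff_ord hf, mem_H0_iff_ord hf]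
  constructor
  · intro h
    refine ⟨fun y => ?_, ?_⟩
    · have := h y
      rw [Finsupp.sub_apply, Finsupp.single_apply] at this
      split_ifs at this <;> omega
    · have := h x
      rw [Finsupp.sub_apply, Finsupp.single_apply, if_pos rfl] at this
      omega
  · rintro ⟨h, h1⟩ y
    rw [Finsupp.sub_apply, Finsupp.single_apply]
    split_ifs with hxy
    · subst hxy; omega
    · have := h y; omega

theorem finrank_H0_le_of_mul {D E : Divisor F K} [FiniteDimensional F (H0 E)] {f : K}
    (hf : f ≠ 0) (h : ∀ g ∈ H0 D, f * g ∈ H0 E) :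
    Module.finrank F (H0 D) ≤ Module.finrank F (H0 E) := by
  have hinj : Function.Injective (LinearMap.mulLeft F f) := mul_right_injective₀ hf
  rw [(Submodule.equivMapOfInjective _ hinj (H0 D)).finrank_eq]
  refine Submodule.finrank_mono ?_
  rintro _ ⟨g, hg, rfl⟩
  exact h g hg

theorem H0_eq_bot_or (D : Divisor F K) : H0 D = ⊥ ∨ ∃ f ∈ H0 D, f ≠ 0 := by
  by_cases h : H0 D = ⊥
  · exact .inl h
  · exact .inr ((Submodule.ne_bot_iff _).1 h)

end Degree

/-- `K` is the function field of a smooth projective curve of genus one with a closed point. -/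
class GenusOne (F K : Type*) [Field F] [Field K] [Algebra F K] : Prop where
  isCurve : IsCurve F K
  hasGenus : HasGenus F K 1
  nonempty : Nonempty (Point F K)

/-! ### Degree of principal divisors and residue fields, from Riemann's definition of the genus -/

section GenusOne

variable {F K : Type*} [Field F] [Field K] [Algebra F K] [GenusOne F K]

theorem degree_le_finrank (D : Divisor F K) : D.degree ≤ Module.finrank F (H0 D) := by
  have := (GenusOne.hasGenus (F := F) (K := K)).2 ⟨D, rfl⟩
  dsimp only at this
  simp only [H0]
  omega

variable (F K) in
theorem exists_degree_eq_finrank : ∃ D : Divisor F K, D.degree = Module.finrank F (H0 D) := by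
  obtain ⟨D, hD⟩ := (GenusOne.hasGenus (F := F) (K := K)).1
  refine ⟨D, ?_⟩
  dsimp only at hD
  simp only [H0]
  omega

/-- `finrank` is zero on infinite-dimensional spaces, so a positive value proves finiteness.
Riemann's inequality gives one as soon as the degree is positive, and adding a multiple of a point
achieves that. -/
instance finiteDimensional_H0 (D : Divisor F K) : FiniteDimensional F (H0 D) := by
  obtain ⟨p⟩ := GenusOne.nonempty (F := F) (K := K)
  set E := D + Finsupp.single p (max 0 (1 - D.degree)) with hE
  have hdeg : 0 < E.degree := by
    rw [hE, Divisor.degree_add, Divisor.degree_single]; omega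
  have hfin : FiniteDimensional F (H0 E) := by
    refine Module.finite_of_finrank_pos ?_
    have := degree_le_finrank E
    omega
  have hle : H0 D ≤ H0 E := H0_mono <| by
    rw [hE]
    exact le_add_of_nonneg_right (Finsupp.single_nonneg.2 (le_max_left _ _))
  exact Submodule.finiteDimensional_of_le hle

variable (F) in
theorem isAlgebraic_adjoin {f : K} (hf : Transcendental F f) :
    Algebra.IsAlgebraic (Algebra.adjoin F {f}) K := by
  have hi : AlgebraicIndependent F (fun _ : Unit => f) :=
    algebraicIndependent_unique_type_iff.2 hf
  have h := hi.isTranscendenceBasis_of_lift_trdeg_le_of_finite (by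
    rw [(GenusOne.isCurve (F := F) (K := K)).trdeg_eq_one]; simp)
  have := h.isAlgebraic
  rwa [Set.range_const] at this

variable [IsAlgClosed F]

/-- The functions regular everywhere form a finite-dimensional domain over an algebraically closed
field. -/
theorem exists_algebraMap_eq_of_mem_H0 {f : K} (hf : f ∈ H0 (0 : Divisor F K)) :
    ∃ c : F, algebraMap F K c = f := by
  let A : Subalgebra F K :=
    { H0 (0 : Divisor F K) with
      mul_mem' := fun {a b} ha hb => by simpa using mul_mem_H0 (D := 0) (E := 0) ha hb
      one_mem' := one_mem_H0_zero
      algebraMap_mem' := algebraMap_mem_H0_zero }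
  have hfin : Module.Finite F A := finiteDimensional_H0 (F := F) (K := K) 0
  obtain ⟨c, hc⟩ := (IsAlgClosed.algebraMap_bijective_of_isIntegral
    (k := F) (K := A)).2 ⟨f, hf⟩
  exact ⟨c, congrArg Subtype.val hc⟩

variable (F K) in
theorem H0_zero_eq : H0 (0 : Divisor F K) = Submodule.span F {(1 : K)} := by
  ext f
  rw [Submodule.mem_span_singleton]
  constructor
  · intro hf
    obtain ⟨c, rfl⟩ := exists_algebraMap_eq_of_mem_H0 hf
    exact ⟨c, (Algebra.algebraMap_eq_smul_one c).symm⟩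
  · rintro ⟨c, rfl⟩
    exact Submodule.smul_mem _ _ one_mem_H0_zero

variable (F K) in
theorem finrank_H0_zero : Module.finrank F (H0 (0 : Divisor F K)) = 1 := by
  rw [H0_zero_eq, finrank_span_singleton one_ne_zero]

/-- This replaces the product formula. If `deg D < 0`, multiplication by `f ^ 2` embeds `H0 (-2D)`,
of dimension at least 2 by Riemann's inequality, into the constants. -/
theorem degree_nonneg_of_mem_H0 {D : Divisor F K} {f : K} (hf : f ∈ H0 D) (h0 : f ≠ 0) :
    0 ≤ D.degree := by
  by_contra! hneg
  have h1 : Module.finrank F (H0 (-(2 • D))) ≤ Module.finrank F (H0 (0 : Divisor F K)) := by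
    refine finrank_H0_le_of_mul (pow_ne_zero 2 h0) fun g hg => ?_
    simpa using mul_mem_H0 (pow_mem_H0 hf 2) hg
  have h2 := degree_le_finrank (-(2 • D))
  rw [Divisor.degree_neg, Divisor.degree_nsmul] at h2
  rw [finrank_H0_zero] at h1
  push_cast at h2
  omega

theorem H0_eq_bot_of_degree_neg {D : Divisor F K} (h : D.degree < 0) : H0 D = ⊥ := by
  rcases H0_eq_bot_or D with h' | ⟨f, hf, h0⟩
  · exact h'
  · exact absurd (degree_nonneg_of_mem_H0 hf h0) (by omega)

/-- A section of a line bundle of degree zero has no zeros. -/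
theorem ord_eq_of_degree_eq_zero {D : Divisor F K} (hD : D.degree = 0) {f : K} (hf : f ∈ H0 D)
    (h0 : f ≠ 0) (x : Point F K) : x.ord f = -D x := by
  have h := (mem_H0_iff_ord h0).1 hf x
  by_contra hne
  have := degree_nonneg_of_mem_H0 ((mem_H0_sub_single (x := x) h0).2 ⟨hf, by omega⟩) h0
  rw [Divisor.degree_sub, Divisor.degree_single] at this
  omega

/-- Nonnegativity of the degree, applied to both `f` and `f⁻¹`, makes the degree of a principal
divisor vanish; conversely a section in degree zero has no room for a further zero. -/
theorem mem_principalDivisors_iff {D : Divisor F K} :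
    D ∈ principalDivisors F K ↔ D.degree = 0 ∧ ∃ f ∈ H0 D, f ≠ 0 := by
  constructor
  · rintro ⟨f, h0, hf⟩
    have h1 : f ∈ H0 (-D) := (mem_H0_iff_ord h0).2 fun x => by simp [hf x]
    have h2 : f⁻¹ ∈ H0 D := (mem_H0_iff_ord (inv_ne_zero h0)).2 fun x => by
      simp [hf x, x.ord_inv]
    have h3 := degree_nonneg_of_mem_H0 h1 h0
    have h4 := degree_nonneg_of_mem_H0 h2 (inv_ne_zero h0)
    rw [Divisor.degree_neg] at h3
    exact ⟨by omega, f⁻¹, h2, inv_ne_zero h0⟩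
  · rintro ⟨hD, f, hf, h0⟩
    refine ⟨f⁻¹, inv_ne_zero h0, fun x => ?_⟩
    rw [x.ord_inv, ord_eq_of_degree_eq_zero hD hf h0, neg_neg]

theorem degree_eq_zero_of_mem {D : Divisor F K} (h : D ∈ principalDivisors F K) :
    D.degree = 0 := (mem_principalDivisors_iff.1 h).1

/-- The residue field of a point is the base field. -/
theorem Point.exists_residue (x : Point F K) {f : K} (hf : x.v f ≤ 1) :
    ∃ c : F, x.v (f - algebraMap F K c) < 1 := by
  by_contra! h
  have h1 : ∀ c : F, x.v (f - algebraMap F K c) = 1 := fun c =>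
    le_antisymm (Valuation.map_sub_le _ hf (x.v_algebraMap_le_one c)) (h c)
  -- If no constant is congruent to `f`, every linear factor `f - c` is a unit at `x`, hence so is
  -- every nonzero polynomial in `f`.
  have hpoly : ∀ P : Polynomial F, P ≠ 0 → x.v (Polynomial.aeval f P) = 1 := by
    intro P hP
    have hs := (IsAlgClosed.splits P).eq_prod_roots
    rw [hs, map_mul, map_mul, Polynomial.aeval_C, x.trivial _ (by simpa using hP), one_mul,
      map_multiset_prod, map_multiset_prod, Multiset.map_map, Multiset.map_map]
    refine Multiset.prod_eq_one fun a ha => ?_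
    obtain ⟨c, -, rfl⟩ := Multiset.mem_map.1 ha
    simp [h1 c]
  have htr : Transcendental F f := by
    rw [transcendental_iff]
    intro P hP
    by_contra hne
    have := hpoly P hne
    simp [hP] at this
  have halg := isAlgebraic_adjoin F htr
  -- Each `g` becomes integral over `F[f]` after multiplication by a nonzero polynomial in `f`,
  -- which is a unit at `x`. So the valuation would be bounded by 1, contradicting its surjectivity.
  have hle : ∀ g : K, x.v g ≤ 1 := by
    intro g
    obtain ⟨y, hy0, hy⟩ := (halg.isAlgebraic g).exists_integral_multiple
    obtain ⟨P, hP⟩ := exists_aeval_eq_of_mem_adjoin y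
    have h2 : x.v (y • g) ≤ 1 := x.v_le_one_of_isIntegral hf hy
    have hP0 : P ≠ 0 := by
      rintro rfl
      exact hy0 (Subtype.ext (by simpa using hP.symm))
    rw [Algebra.smul_def, map_mul] at h2
    have h3 : x.v (algebraMap (Algebra.adjoin F {f}) K y) = 1 := by
      have := hpoly P hP0
      rwa [hP] at this
    rwa [h3, one_mul] at h2
  obtain ⟨g, hg⟩ := x.surjective (WithZero.exp 1)
  have := hle g
  rw [hg, ← WithZero.exp_zero, WithZero.exp_le_exp] at this
  omega

end GenusOne

/-! ### Riemann-Roch in genus one, and finiteness of zeros and poles -/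

section GenusOne

variable {F K : Type*} [Field F] [Field K] [Algebra F K]

theorem H0_sub_single_le (D : Divisor F K) (x : Point F K) :
    H0 (D - Finsupp.single x 1) ≤ H0 D :=
  H0_mono (sub_le_self D (Finsupp.single_nonneg.2 zero_le_one))

variable [GenusOne F K] [IsAlgClosed F]

/-- As the residue field is `F`, any two sections of the minimal order at `x` agree up to a scalar
modulo sections of higher order. -/
theorem finrank_H0_le_sub_single (D : Divisor F K) (x : Point F K) :
    Module.finrank F (H0 D) ≤ Module.finrank F (H0 (D - Finsupp.single x 1)) + 1 := by
  by_cases hle : H0 D ≤ H0 (D - Finsupp.single x 1)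
  · exact (Submodule.finrank_mono hle).trans (Nat.le_succ _)
  obtain ⟨f, hf, hf'⟩ := Set.not_subset.1 hle
  have h0 : f ≠ 0 := by
    rintro rfl
    exact hf' (zero_mem _)
  have hord : x.ord f = -D x := by
    have h1 := (mem_H0_iff_ord h0).1 hf x
    have h2 : ¬ 1 ≤ x.ord f + D x := fun h => hf' ((mem_H0_sub_single h0).2 ⟨hf, h⟩)
    omega
  have hsup : H0 D ≤ H0 (D - Finsupp.single x 1) ⊔ Submodule.span F {f} := by
    intro g hg
    have hv : x.v (g / f) ≤ 1 := by
      by_cases hg0 : g = 0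
      · simp [hg0]
      rw [x.v_le_one_iff (div_ne_zero hg0 h0), div_eq_mul_inv, x.ord_mul hg0 (inv_ne_zero h0),
        x.ord_inv, hord]
      have := (mem_H0_iff_ord hg0).1 hg x
      omega
    obtain ⟨c, hc⟩ := x.exists_residue hv
    rw [← sub_add_cancel g (c • f)]
    refine Submodule.add_mem_sup ?_ (Submodule.smul_mem _ _ (Submodule.mem_span_singleton_self f))
    by_cases hz : g - c • f = 0
    · rw [hz]; exact zero_mem _
    refine (mem_H0_sub_single hz).2 ⟨sub_mem hg (Submodule.smul_mem _ _ hf), ?_⟩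
    have heq : g / f - algebraMap F K c = (g - c • f) * f⁻¹ := by
      rw [Algebra.smul_def]; field_simp
    rw [heq, x.v_lt_one_iff (mul_ne_zero hz (inv_ne_zero h0)), x.ord_mul hz (inv_ne_zero h0),
      x.ord_inv, hord] at hc
    omega
  calc Module.finrank F (H0 D)
      ≤ Module.finrank F ↥(H0 (D - Finsupp.single x 1) ⊔ Submodule.span F {f}) :=
        Submodule.finrank_mono hsup
    _ ≤ Module.finrank F (H0 (D - Finsupp.single x 1)) + Module.finrank F (Submodule.span F {f}) :=
        Submodule.finrank_add_le_finrank_add_finrank _ _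
    _ ≤ _ := by rw [finrank_span_singleton h0]

theorem finrank_H0_le_one_of_degree_eq_zero {D : Divisor F K} (hD : D.degree = 0) :
    Module.finrank F (H0 D) ≤ 1 := by
  obtain ⟨p⟩ := GenusOne.nonempty (F := F) (K := K)
  refine (finrank_H0_le_sub_single D p).trans ?_
  rw [H0_eq_bot_of_degree_neg (by rw [Divisor.degree_sub, Divisor.degree_single]; omega)]
  simp

/-- A section of a line bundle of positive degree has a zero. -/
theorem exists_mem_H0_sub_single {D : Divisor F K} (hD : 0 < D.degree) {f : K} (hf : f ∈ H0 D)
    (h0 : f ≠ 0) : ∃ x : Point F K, f ∈ H0 (D - Finsupp.single x 1) := by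
  suffices hex : ∃ x : Point F K, 1 ≤ x.ord f + D x by
    obtain ⟨x, hx⟩ := hex
    exact ⟨x, (mem_H0_sub_single h0).2 ⟨hf, hx⟩⟩
  by_contra! h
  have : D ∈ principalDivisors F K := by
    refine ⟨f⁻¹, inv_ne_zero h0, fun x => ?_⟩
    have h1 := (mem_H0_iff_ord h0).1 hf x
    have h2 := h x
    rw [x.ord_inv]
    omega
  have := degree_eq_zero_of_mem this
  omega

/-- A curve of genus one has no pencil of degree one. -/
theorem finrank_H0_le_one_of_degree_eq_one {D : Divisor F K} (hD : D.degree = 1) :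
    Module.finrank F (H0 D) ≤ 1 := by
  by_contra! h2
  have hsub : ∀ y : Point F K, ∃ f ∈ H0 (D - Finsupp.single y 1), f ≠ 0 := by
    intro y
    rcases H0_eq_bot_or (D - Finsupp.single y 1) with h | h
    · have := finrank_H0_le_sub_single D y
      rw [h] at this
      simp at this
      omega
    · exact h
  have hsubdeg : ∀ y : Point F K, (D - Finsupp.single y 1).degree = 0 := fun y => by
    rw [Divisor.degree_sub, Divisor.degree_single, hD]; norm_num
  -- A pencil of degree one behaves as on the projective line: multiplying by a section `u`
  -- vanishing at `y` embeds `H0 (k • D)` into the sections of `(k + 1) • D` vanishing at `y`, and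
  -- `w ^ (k + 1)` does not vanish there.
  have hpow : ∀ k : ℕ, k + 1 ≤ Module.finrank F (H0 (k • D)) := by
    obtain ⟨y⟩ := GenusOne.nonempty (F := F) (K := K)
    obtain ⟨u, hu, hu0⟩ := hsub y
    obtain ⟨w, hw, hw'⟩ : ∃ w ∈ H0 D, w ∉ H0 (D - Finsupp.single y 1) := by
      refine Set.not_subset.1 fun hle => ?_
      have h1 := Submodule.finrank_mono (show H0 D ≤ H0 (D - Finsupp.single y 1) from hle)
      have h3 := finrank_H0_le_one_of_degree_eq_zero (hsubdeg y)
      omega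
    have hw0 : w ≠ 0 := by
      rintro rfl
      exact hw' (zero_mem _)
    have hword : y.ord w = -D y := by
      have h1 := (mem_H0_iff_ord hw0).1 hw y
      have h2 : ¬ 1 ≤ y.ord w + D y := fun h => hw' ((mem_H0_sub_single hw0).2 ⟨hw, h⟩)
      omega
    intro k
    induction k with
    | zero => rw [zero_nsmul, finrank_H0_zero]
    | succ k ih =>
      have h1 : Module.finrank F (H0 (k • D)) ≤
          Module.finrank F (H0 ((k + 1) • D - Finsupp.single y 1)) := by
        refine finrank_H0_le_of_mul hu0 fun g hg => ?_
        have := mul_mem_H0 hu hg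
        rwa [show D - Finsupp.single y 1 + k • D = (k + 1) • D - Finsupp.single y 1 by
          rw [succ_nsmul]; abel] at this
      have h3 : H0 ((k + 1) • D - Finsupp.single y 1) < H0 ((k + 1) • D) := by
        refine lt_of_le_of_ne (H0_sub_single_le _ _) fun heq => ?_
        have h4 := pow_mem_H0 hw (k + 1)
        rw [← heq, mem_H0_sub_single (pow_ne_zero _ hw0), y.ord_pow, hword] at h4
        have h5 := h4.2
        rw [Finsupp.smul_apply, nsmul_eq_mul] at h5
        linarith
      have := Submodule.finrank_lt_finrank_of_lt h3
      omega
  -- A divisor `E` attaining the genus gives the contradiction. With `e = deg E`, a section of `E -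
  -- e D + D` vanishes at some `y`; since `D - y` is principal, `E - e D` has a section, so `e + 1 ≤
  -- h⁰(e D) ≤ h⁰(E) = e`.
  obtain ⟨E, hE⟩ := exists_degree_eq_finrank F K
  obtain ⟨e, he⟩ := Int.eq_ofNat_of_zero_le (show 0 ≤ E.degree by omega)
  have hdeg : (E - e • D + D).degree = 1 := by
    rw [Divisor.degree_add, Divisor.degree_sub, Divisor.degree_nsmul, hD, he]; ring
  obtain ⟨u, hu, hu0⟩ : ∃ u ∈ H0 (E - e • D + D), u ≠ 0 := by
    rcases H0_eq_bot_or (E - e • D + D) with h | h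
    · have := degree_le_finrank (E - e • D + D)
      rw [h, hdeg] at this
      simp at this
    · exact h
  obtain ⟨y, hy⟩ := exists_mem_H0_sub_single (by omega) hu hu0
  obtain ⟨w, hw, hw0⟩ := hsub y
  have huw : u * w⁻¹ ∈ H0 (E - e • D) := by
    refine (mem_H0_iff_ord (mul_ne_zero hu0 (inv_ne_zero hw0))).2 fun x => ?_
    have h1 := (mem_H0_iff_ord hu0).1 hy x
    have h3 := ord_eq_of_degree_eq_zero (hsubdeg y) hw hw0 x
    rw [x.ord_mul hu0 (inv_ne_zero hw0), x.ord_inv, h3]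
    simp only [Finsupp.sub_apply, Finsupp.add_apply] at h1 ⊢
    omega
  have := finrank_H0_le_of_mul (D := e • D) (E := E) (mul_ne_zero hu0 (inv_ne_zero hw0))
    fun g hg => by simpa using mul_mem_H0 huw hg
  have := hpow e
  omega

/-- Riemann-Roch in positive degree. -/
theorem finrank_H0_of_degree_pos {D : Divisor F K} (hD : 0 < D.degree) :
    (Module.finrank F (H0 D) : ℤ) = D.degree := by
  refine le_antisymm ?_ (degree_le_finrank D)
  obtain ⟨p⟩ := GenusOne.nonempty (F := F) (K := K)
  obtain ⟨n, hn⟩ := Int.eq_ofNat_of_zero_le (show 0 ≤ D.degree - 1 by omega)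
  induction n generalizing D with
  | zero =>
    have := finrank_H0_le_one_of_degree_eq_one (D := D) (by push_cast at hn; omega)
    push_cast at hn
    omega
  | succ n ih =>
    have hdeg : (D - Finsupp.single p 1).degree = D.degree - 1 := by
      rw [Divisor.degree_sub, Divisor.degree_single]
    have h1 := ih (D := D - Finsupp.single p 1) (by push_cast at hn; omega)
      (by push_cast at hn; omega)
    have h2 := finrank_H0_le_sub_single D p
    omega

omit [IsAlgClosed F] in
theorem exists_mem_H0_of_degree_pos {D : Divisor F K} (hD : 0 < D.degree) :
    ∃ f ∈ H0 D, f ≠ 0 := by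
  rcases H0_eq_bot_or D with h | h
  · have := degree_le_finrank D
    rw [h] at this
    simp at this
    omega
  · exact h

/-- A divisor of degree one is equivalent to a point. -/
theorem exists_sub_single_mem_principalDivisors {D : Divisor F K} (hD : D.degree = 1) :
    ∃ x : Point F K, D - Finsupp.single x 1 ∈ principalDivisors F K := by
  obtain ⟨f, hf, h0⟩ := exists_mem_H0_of_degree_pos (D := D) (by omega)
  obtain ⟨x, hx⟩ := exists_mem_H0_sub_single (by omega) hf h0
  refine ⟨x, mem_principalDivisors_iff.2 ⟨?_, f, hx, h0⟩⟩
  rw [Divisor.degree_sub, Divisor.degree_single]; omega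

/-- A function with at most a simple pole at `y` and no other pole is constant, so it cannot vanish
at `x`. -/
theorem eq_of_single_sub_single_mem {x y : Point F K}
    (h : Finsupp.single x 1 - Finsupp.single y 1 ∈ principalDivisors F K) : x = y := by
  classical
  obtain ⟨f, h0, hf⟩ := h
  by_contra hne
  have hx := hf x
  rw [Finsupp.sub_apply, Finsupp.single_eq_same, Finsupp.single_apply,
    if_neg (Ne.symm hne)] at hx
  have hmem : f ∈ H0 (Finsupp.single y 1 : Divisor F K) := by
    refine (mem_H0_iff_ord h0).2 fun z => ?_
    rw [← hf z, Finsupp.sub_apply, sub_add_cancel, Finsupp.single_apply]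
    split_ifs <;> simp
  have hle : H0 (0 : Divisor F K) ≤ H0 (Finsupp.single y 1) :=
    H0_mono (Finsupp.single_nonneg.2 zero_le_one)
  have heq : H0 (0 : Divisor F K) = H0 (Finsupp.single y 1) := by
    refine Submodule.eq_of_le_of_finrank_le hle ?_
    rw [finrank_H0_zero]
    exact finrank_H0_le_one_of_degree_eq_one (Divisor.degree_single y 1)
  rw [← heq] at hmem
  have := ord_eq_of_degree_eq_zero Divisor.degree_zero hmem h0 x
  simp at this
  omega

/-- Since `h⁰(2x) = 2` exceeds `h⁰(0) = 1`, a nonconstant function has its only pole at `x`. That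
pole has order two, because `h⁰(x) = 1`. -/
theorem exists_simple_pole (x : Point F K) :
    ∃ h : K, h ∈ H0 (Finsupp.single x 2 : Divisor F K) ∧ 1 < x.v h := by
  have h1 : (Module.finrank F (H0 (Finsupp.single x 2 : Divisor F K)) : ℤ) = 2 := by
    rw [finrank_H0_of_degree_pos] <;> rw [Divisor.degree_single]
    norm_num
  obtain ⟨h, hh, hn⟩ : ∃ h ∈ H0 (Finsupp.single x 2 : Divisor F K), h ∉ H0 (0 : Divisor F K) := by
    refine Set.not_subset.1 fun hle => ?_
    have := Submodule.finrank_mono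
      (show H0 (Finsupp.single x 2 : Divisor F K) ≤ H0 (0 : Divisor F K) from hle)
    rw [finrank_H0_zero] at this
    omega
  refine ⟨h, hh, ?_⟩
  classical
  by_contra! hle
  refine hn (mem_H0_zero.2 fun y => ?_)
  by_cases hxy : x = y
  · rwa [← hxy]
  · have := mem_H0.1 hh y
    rwa [Finsupp.single_apply, if_neg hxy, WithZero.exp_zero] at this

/-- The zeros are subtracted from `D` one at a time; `f` remains a section, so the degree stays
nonnegative. -/
theorem card_le_degree {D : Divisor F K} {f : K} (hf : f ∈ H0 D) (h0 : f ≠ 0)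
    (S : Finset (Point F K)) (hS : ∀ x ∈ S, 1 ≤ x.ord f + D x) : (S.card : ℤ) ≤ D.degree := by
  classical
  suffices h : ∃ E : Divisor F K, f ∈ H0 E ∧ E.degree = D.degree - S.card ∧
      ∀ x ∉ S, E x = D x by
    obtain ⟨E, hE, hdeg, -⟩ := h
    have := degree_nonneg_of_mem_H0 hE h0
    omega
  induction S using Finset.induction_on with
  | empty => exact ⟨D, hf, by simp, fun _ _ => rfl⟩
  | insert a S ha ih =>
    obtain ⟨E, hE, hdeg, hEx⟩ := ih fun x hx => hS x (Finset.mem_insert_of_mem hx)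
    refine ⟨E - Finsupp.single a 1, (mem_H0_sub_single h0).2 ⟨hE, ?_⟩, ?_, fun x hx => ?_⟩
    · rw [hEx a ha]
      exact hS a (Finset.mem_insert_self a S)
    · rw [Divisor.degree_sub, Divisor.degree_single, hdeg, Finset.card_insert_of_notMem ha]
      push_cast
      ring
    · rw [Finset.mem_insert, not_or] at hx
      rw [Finsupp.sub_apply, Finsupp.single_apply, if_neg (Ne.symm hx.1), hEx x hx.2, sub_zero]

theorem finite_zeros_of_mem_H0 {D : Divisor F K} {f : K} (hf : f ∈ H0 D) (h0 : f ≠ 0) :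
    {x : Point F K | x.v f < 1}.Finite := by
  have hfin : {x : Point F K | 1 ≤ x.ord f + D x}.Finite := by
    by_contra hinf
    obtain ⟨S, hS, hcard⟩ := Set.Infinite.exists_subset_card_eq hinf (D.degree.toNat + 1)
    have := card_le_degree hf h0 S fun x hx => hS hx
    omega
  refine (hfin.union D.hasFiniteSupport).subset fun x hx => ?_
  by_cases hD : D x = 0
  · left
    have := (x.v_lt_one_iff h0).1 hx
    simp only [Set.mem_ofPred_eq]
    omega
  · right
    exact hD

omit [GenusOne F K] [IsAlgClosed F] in
theorem transcendental_of_one_lt {x : Point F K} {h : K} (hx : 1 < x.v h) :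
    Transcendental F h := by
  intro halg
  -- The base ring `F[1]` is just `F`, in the shape `v_le_one_of_isIntegral` accepts.
  have : IsIntegral (Algebra.adjoin F {(1 : K)}) h := halg.isIntegral.tower_top
  exact absurd (x.v_le_one_of_isIntegral (by simp) this) (not_le.2 hx)

/-- Let `h` have its only pole at `p`. Some nonzero polynomial `y` in `h` makes `y f` integral over
`F[h]`, so `f` can have poles only at `p` and at the finitely many zeros of `y`. -/
theorem finite_poles (f : K) : {x : Point F K | 1 < x.v f}.Finite := by
  obtain ⟨p⟩ := GenusOne.nonempty (F := F) (K := K)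
  obtain ⟨h, hh, hp⟩ := exists_simple_pole p
  have halg := isAlgebraic_adjoin F (transcendental_of_one_lt hp)
  obtain ⟨y, hy0, hy⟩ := (halg.isAlgebraic f).exists_integral_multiple
  obtain ⟨P, hP⟩ := exists_aeval_eq_of_mem_adjoin y
  have hymem : (y : K) ∈ H0 (P.natDegree • (Finsupp.single p 2 : Divisor F K)) := by
    rw [← hP, Polynomial.aeval_eq_sum_range]
    refine Submodule.sum_mem _ fun i hi => Submodule.smul_mem _ _ ?_
    refine H0_mono ?_ (pow_mem_H0 hh i)
    exact nsmul_le_nsmul_left (Finsupp.single_nonneg.2 zero_le_two)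
      (Nat.lt_succ_iff.1 (Finset.mem_range.1 hi))
  have hy0' : (y : K) ≠ 0 := fun h => hy0 (Subtype.ext h)
  refine ((finite_zeros_of_mem_H0 hymem hy0').union (Set.finite_singleton p)).subset
    fun x hx => ?_
  by_contra hnot
  simp only [Set.mem_union, Set.mem_ofPred_eq, Set.mem_singleton_iff, not_or, not_lt] at hnot
  have hxh : x.v h ≤ 1 := by
    classical
    have := mem_H0.1 hh x
    rwa [Finsupp.single_apply, if_neg (Ne.symm hnot.2), WithZero.exp_zero] at this
  have h1 := x.v_le_one_of_isIntegral hxh hy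
  rw [Algebra.smul_def, map_mul] at h1
  exact absurd h1 (not_le.2 (hx.trans_le (le_mul_of_one_le_left' hnot.1)))

theorem finite_v_ne_one {f : K} (h0 : f ≠ 0) : {x : Point F K | x.v f ≠ 1}.Finite := by
  refine ((finite_poles f).union (finite_poles f⁻¹)).subset fun x hx => ?_
  rcases lt_or_gt_of_ne (show x.v f ≠ 1 from hx) with h | h
  · right
    rw [Set.mem_ofPred_eq, map_inv₀]
    exact (one_lt_inv₀ (zero_lt_iff.2 ((Valuation.ne_zero_iff _).2 h0))).2 h
  · exact .inl h

theorem exists_v_lt_one {p : Point F K} {f : K} (hp : 1 < p.v f) :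
    ∃ x : Point F K, x.v f < 1 := by
  by_contra! h
  have h0 : f ≠ 0 := by
    rintro rfl
    simp at hp
  have hmem : f⁻¹ ∈ H0 (0 : Divisor F K) := mem_H0_zero.2 fun x => by
    rw [map_inv₀]
    exact inv_le_one_of_one_le₀ (h x)
  obtain ⟨c, hc⟩ := exists_algebraMap_eq_of_mem_H0 hmem
  have hf : f = algebraMap F K c⁻¹ := by rw [map_inv₀, hc, inv_inv]
  rw [hf] at hp
  exact absurd (p.v_algebraMap_le_one c⁻¹) (not_le.2 hp)

variable (F K) in
theorem infinite_point : Infinite (Point F K) := by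
  obtain ⟨p⟩ := GenusOne.nonempty (F := F) (K := K)
  obtain ⟨h, -, hp⟩ := exists_simple_pole p
  -- A nonconstant function takes every value, so the curve has at least as many points as the
  -- infinite field `F`.
  have hex : ∀ c : F, ∃ x : Point F K, x.v (h - algebraMap F K c) < 1 := fun c => by
    refine exists_v_lt_one (p := p) ?_
    rwa [Valuation.map_sub_eq_of_lt_left _ ((p.v_algebraMap_le_one c).trans_lt hp)]
  choose φ hφ using hex
  refine Infinite.of_injective φ fun c d hcd => ?_
  by_contra hne
  have h1 := hφ d
  rw [← hcd] at h1
  have h2 := Valuation.map_sub_lt _ h1 (hφ c)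
  rw [sub_sub_sub_cancel_left, ← map_sub, (φ c).trivial _ (sub_ne_zero.2 hne)] at h2
  exact lt_irrefl _ h2

end GenusOne

/-! ### Combinatorics of linked sequences -/

section Admissible

variable {r : ℕ}

theorem increasable_iff {α : Fin (r + 1) → ℤ} (hα : Monotone α) (i : Fin (r + 1)) :
    Increasable α i ↔ ∀ j : Fin (r + 1), (j : ℕ) = i + 1 → α i + 1 ≤ α j := by
  constructor
  · intro h j hj
    have hij : i ≤ j := Fin.le_def.2 (by omega)
    have hne : j ≠ i := fun h => by rw [h] at hj; omega
    have := h hij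
    rwa [Function.update_self, Function.update_of_ne hne] at this
  · intro h a b hab
    have hab' := hα hab
    rcases eq_or_ne i a with rfl | ha <;> rcases eq_or_ne i b with rfl | hb
    · exact le_rfl
    · rw [Function.update_self, Function.update_of_ne hb.symm]
      have hlt : (i : ℕ) < b := lt_of_le_of_ne hab fun h' => hb (Fin.ext h')
      let c : Fin (r + 1) := ⟨i + 1, by omega⟩
      exact (h c rfl).trans (hα (Fin.le_def.2 hlt))
    · rw [Function.update_self, Function.update_of_ne ha.symm]
      omega
    · rwa [Function.update_of_ne ha.symm, Function.update_of_ne hb.symm]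

theorem decreasable_iff {α : Fin (r + 1) → ℤ} (hα : Monotone α) (i : Fin (r + 1)) :
    Decreasable α i ↔ ∀ j : Fin (r + 1), (j : ℕ) + 1 = i → α j ≤ α i - 1 := by
  constructor
  · intro h j hj
    have hij : j ≤ i := Fin.le_def.2 (by omega)
    have hne : j ≠ i := fun h => by rw [h] at hj; omega
    have := h hij
    rwa [Function.update_self, Function.update_of_ne hne] at this
  · intro h a b hab
    have hab' := hα hab
    rcases eq_or_ne i b with rfl | hb <;> rcases eq_or_ne i a with rfl | ha
    · exact le_rfl
    · rw [Function.update_self, Function.update_of_ne ha.symm]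
      have hlt : (a : ℕ) < i := lt_of_le_of_ne hab fun h' => ha (Fin.ext h'.symm)
      let c : Fin (r + 1) := ⟨i - 1, by omega⟩
      have hc : (c : ℕ) + 1 = i := by simp only [c]; omega
      exact (hα (Fin.le_def.2 (by omega))).trans (h c hc)
    · rw [Function.update_self, Function.update_of_ne hb.symm]
      omega
    · rwa [Function.update_of_ne ha.symm, Function.update_of_ne hb.symm]

/-- The conditions on the entries of `α` and `β` that say that they are linked by `Λ`. -/
structure IsAdmissible (Λ : Set ℤ) (α β : Fin (r + 1) → ℤ) : Prop where
  step : ∀ i, β i = α i ∨ β i = α i + 1 ∧ α i + (i : ℕ) + 1 ∈ Λ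
  low : ∀ i, β i = α i → α i + (i : ℕ) + 1 ∈ Λ →
    ∃ j : Fin (r + 1), (j : ℕ) = i + 1 ∧ α j = α i ∧ β j = β i
  high : ∀ i, β i = α i → α i + (i : ℕ) ∈ Λ →
    ∃ j : Fin (r + 1), (j : ℕ) + 1 = i ∧ α j = α i ∧ β j = β i

/-- An entry selected by `Λ` fails to move only if it is blocked by an equal neighbour. As `Λ` has
no two consecutive elements, `Λ` does not select that neighbour for the same displacement, so it
stays as well; `low` and `high` record this for the two displacements. -/
theorem isAdmissible_iff_linked {Λ : Set ℤ} {α β : Fin (r + 1) → ℤ} (hα : Monotone α)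
    (hβ : Monotone β) (hαβ : α ≤ β) (hΛ : ∀ k ∈ Λ, k + 1 ∉ Λ) :
    IsAdmissible Λ α β ↔ Linked Λ α β := by
  constructor
  · intro h
    refine ⟨hαβ, funext fun i => ?_, funext fun i => ?_⟩
    · rw [dispDown, decreasable_iff hβ]
      rcases h.step i with hi | ⟨hi, hm⟩
      · rw [if_neg, hi]
        rintro ⟨hd, hm⟩
        rw [hi] at hm
        obtain ⟨j, hj, -, hj'⟩ := h.high i hi hm
        have := hd j hj
        omega
      · rw [if_pos, hi, add_sub_cancel_right]
        refine ⟨fun j hj => ?_, by rwa [hi, add_right_comm]⟩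
        by_contra! hlt
        have h1 : β j ≤ β i := hβ (Fin.le_def.2 (by omega))
        have h2 : α j ≤ α i := hα (Fin.le_def.2 (by omega))
        rcases h.step j with hj' | ⟨hj', hm'⟩
        · omega
        · refine hΛ _ hm' ?_
          rwa [show α j + ((j : ℕ) : ℤ) + 1 + 1 = α i + (i : ℕ) + 1 by omega]
    · rw [dispUp, increasable_iff hα]
      rcases h.step i with hi | ⟨hi, hm⟩
      · rw [if_neg, hi]
        rintro ⟨hd, hm⟩
        obtain ⟨j, hj, hj', -⟩ := h.low i hi hm
        have := hd j hj
        omega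
      · rw [if_pos, hi]
        refine ⟨fun j hj => ?_, hm⟩
        by_contra! hlt
        have h1 : β i ≤ β j := hβ (Fin.le_def.2 (by omega))
        have h2 : α i ≤ α j := hα (Fin.le_def.2 (by omega))
        rcases h.step j with hj' | ⟨hj', hm'⟩
        · omega
        · refine hΛ _ hm ?_
          rwa [show α i + ((i : ℕ) : ℤ) + 1 + 1 = α j + (j : ℕ) + 1 by omega]
  · rintro ⟨-, hdown, hup⟩
    have hup' : ∀ i, β i = dispUp Λ α i := congrFun hup
    have hdown' : ∀ i, α i = dispDown Λ β i := congrFun hdown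
    simp only [dispUp] at hup'
    simp only [dispDown] at hdown'
    refine ⟨fun i => ?_, fun i hi hm => ?_, fun i hi hm => ?_⟩
    · have := hup' i
      split_ifs at this with h
      · exact .inr ⟨this, h.2⟩
      · exact .inl this
    · have h1 := hup' i
      have hn : ¬ ∀ j : Fin (r + 1), (j : ℕ) = i + 1 → α i + 1 ≤ α j := fun h => by
        rw [if_pos ⟨(increasable_iff hα i).2 h, hm⟩] at h1
        omega
      push Not at hn
      obtain ⟨j, hj, hlt⟩ := hn
      have h2 : α i ≤ α j := hα (Fin.le_def.2 (by omega))
      have h3 := hup' j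
      rw [if_neg fun h => hΛ _ hm (by
        rw [show α i + ((i : ℕ) : ℤ) + 1 + 1 = α j + (j : ℕ) + 1 by omega]; exact h.2)] at h3
      exact ⟨j, hj, by omega, by omega⟩
    · have h1 := hdown' i
      have hn : ¬ ∀ j : Fin (r + 1), (j : ℕ) + 1 = i → β j ≤ β i - 1 := fun h => by
        rw [if_pos ⟨(decreasable_iff hβ i).2 h, by rwa [hi]⟩] at h1
        omega
      push Not at hn
      obtain ⟨j, hj, hlt⟩ := hn
      have h2 : β j ≤ β i := hβ (Fin.le_def.2 (by omega))
      have h3 := hdown' j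
      rw [if_neg fun h => hΛ _ h.2 (by
        rwa [show β j + ((j : ℕ) : ℤ) + 1 = α i + (i : ℕ) by omega])] at h3
      exact ⟨j, hj, by omega, by omega⟩

/-- The matching of the vanishing orders at the two points. -/
theorem IsAdmissible.exists_matching {Λ : Set ℤ} {α β : Fin (r + 1) → ℤ}
    (h : IsAdmissible Λ α β) (hΛ : ∀ k ∈ Λ, k + 1 ∉ Λ) :
    ∃ σ : Fin (r + 1) → Fin (r + 1), Function.Bijective σ ∧ ∀ i,
      (β i = α i ∧ α i + (i : ℕ) + 1 ∈ Λ ∧ (σ i : ℕ) = i + 1 ∧ α (σ i) = α i) ∨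
      (β i = α i ∧ α i + (i : ℕ) ∈ Λ ∧ (σ i : ℕ) + 1 = i ∧ α (σ i) = α i) ∨
      (σ i = i ∧ (β i = α i → α i + (i : ℕ) ∉ Λ ∧ α i + (i : ℕ) + 1 ∉ Λ)) := by
  classical
  have hex : ∀ i, ∃ j : Fin (r + 1),
      (β i = α i ∧ α i + (i : ℕ) + 1 ∈ Λ ∧ (j : ℕ) = i + 1 ∧ α j = α i ∧ β j = β i) ∨
      (β i = α i ∧ α i + (i : ℕ) ∈ Λ ∧ (j : ℕ) + 1 = i ∧ α j = α i ∧ β j = β i) ∨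
      (j = i ∧ (β i = α i → α i + (i : ℕ) ∉ Λ ∧ α i + (i : ℕ) + 1 ∉ Λ)) := by
    intro i
    by_cases hi : β i = α i
    · by_cases h1 : α i + (i : ℕ) + 1 ∈ Λ
      · obtain ⟨j, hj⟩ := h.low i hi h1
        exact ⟨j, .inl ⟨hi, h1, hj⟩⟩
      · by_cases h2 : α i + (i : ℕ) ∈ Λ
        · obtain ⟨j, hj⟩ := h.high i hi h2
          exact ⟨j, .inr (.inl ⟨hi, h2, hj⟩)⟩
        · exact ⟨i, .inr (.inr ⟨rfl, fun _ => ⟨h2, h1⟩⟩)⟩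
    · exact ⟨i, .inr (.inr ⟨rfl, fun h => absurd h hi⟩)⟩
  -- `σ` swaps the adjacent unmoved indices `i`, `i + 1` with equal entries and `α i + i + 1 ∈ Λ`,
  -- and fixes all others.
  choose σ hσ using hex
  refine ⟨σ, Finite.injective_iff_bijective.1 fun a b hab => ?_, fun i => ?_⟩
  · have key : ∀ a b : Fin (r + 1), σ a = σ b → (a : ℕ) < b → False := by
      intro a b hab hlt
      have ha := hσ a
      have hb := hσ b
      rw [hab] at ha
      rcases ha with ⟨ha, ham, ha1, ha2, ha3⟩ | ⟨ha, ham, ha1, ha2, ha3⟩ | ⟨ha, ham⟩ <;>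
      rcases hb with ⟨hb, hbm, hb1, hb2, hb3⟩ | ⟨hb, hbm, hb1, hb2, hb3⟩ | ⟨hb, hbm⟩
      · omega
      · refine hΛ _ ham ?_
        rwa [show α a + ((a : ℕ) : ℤ) + 1 + 1 = α b + (b : ℕ) by omega]
      · rw [hb] at ha1 ha2 ha3
        refine (hbm (by omega)).1 ?_
        rwa [show α b + ((b : ℕ) : ℤ) = α a + (a : ℕ) + 1 by omega]
      · omega
      · omega
      · have := congrArg Fin.val hb
        omega
      · have := congrArg Fin.val ha
        omega
      · rw [ha] at hb1 hb2 hb3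
        refine (ham (by omega)).2 ?_
        rwa [show α a + ((a : ℕ) : ℤ) + 1 = α b + (b : ℕ) by omega]
      · have := congrArg Fin.val (ha.symm.trans hb)
        omega
    rcases lt_trichotomy (a : ℕ) b with hlt | heq | hlt
    · exact (key a b hab hlt).elim
    · exact Fin.ext heq
    · exact (key b a hab.symm hlt).elim
  · rcases hσ i with h | h | h
    · exact .inl ⟨h.1, h.2.1, h.2.2.1, h.2.2.2.1⟩
    · exact .inr (.inl ⟨h.1, h.2.1, h.2.2.1, h.2.2.2.1⟩)
    · exact .inr (.inr h)

end Admissible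

/-! ### Sections with exact orders at the two marked points -/

section Twist

variable {F K : Type*} [Field F] [Field K] [Algebra F K]

/-- The divisor `D - a p - b q`. -/
def twist (D : Divisor F K) (p q : Point F K) (a b : ℤ) : Divisor F K :=
  D - Finsupp.single p a - Finsupp.single q b

theorem degree_twist (D : Divisor F K) (p q : Point F K) (a b : ℤ) :
    (twist D p q a b).degree = D.degree - a - b := by
  rw [twist, Divisor.degree_sub, Divisor.degree_sub, Divisor.degree_single,
    Divisor.degree_single]

theorem twist_add_one_left (D : Divisor F K) (p q : Point F K) (a b : ℤ) :
    twist D p q (a + 1) b = twist D p q a b - Finsupp.single p 1 := by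
  rw [twist, twist, Finsupp.single_add]; abel

theorem twist_add_one_right (D : Divisor F K) (p q : Point F K) (a b : ℤ) :
    twist D p q a (b + 1) = twist D p q a b - Finsupp.single q 1 := by
  rw [twist, twist, Finsupp.single_add]; abel

theorem mem_H0_twist {D : Divisor F K} {p q : Point F K} (hpq : p ≠ q) {a b : ℤ} {f : K}
    (h0 : f ≠ 0) : f ∈ H0 (twist D p q a b) ↔
      f ∈ sectionsOn {p, q}ᶜ D ∧ a ≤ p.ord f + D p ∧ b ≤ q.ord f + D q := by
  classical
  have hp : twist D p q a b p = D p - a := by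
    simp [twist, hpq.symm]
  have hq : twist D p q a b q = D q - b := by
    simp [twist, hpq]
  have hx : ∀ x, x ≠ p → x ≠ q → twist D p q a b x = D x := fun x h1 h2 => by
    simp [twist, h1.symm, h2.symm]
  rw [mem_H0_iff_ord h0]
  constructor
  · intro h
    refine ⟨fun x hxpq => ?_, ?_, ?_⟩
    · simp only [Set.mem_compl_iff, Set.mem_insert_iff, Set.mem_singleton_iff, not_or] at hxpq
      rw [x.v_le_exp_iff h0, ← hx x hxpq.1 hxpq.2]
      exact h x
    · have := h p; omega
    · have := h q; omega
  · rintro ⟨h, h1, h2⟩ x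
    by_cases hxp : x = p
    · rw [hxp]; omega
    by_cases hxq : x = q
    · rw [hxq]; omega
    rw [hx x hxp hxq, ← x.v_le_exp_iff h0]
    exact h x (by simp [hxp, hxq])

/-- The integers `k` such that `D` is equivalent to `(deg D - k) p + k q`. -/
def markedClass (D : Divisor F K) (p q : Point F K) : Set ℤ :=
  {k | twist D p q (D.degree - k) k ∈ principalDivisors F K}

/-- `f` is a section of `O(D)` regular away from `p` and `q` that vanishes to order exactly `a`
at `p` and `b` at `q`. -/
structure HasExactOrders (D : Divisor F K) (p q : Point F K) (a b : ℤ) (f : K) : Prop where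
  ne_zero : f ≠ 0
  mem : f ∈ H0 (twist D p q a b)
  ord_p : p.ord f + D p = a
  ord_q : q.ord f + D q = b

theorem hasExactOrders_of_notMem {D : Divisor F K} {p q : Point F K} (hpq : p ≠ q) {a b : ℤ}
    {f : K} (h : f ∈ H0 (twist D p q a b)) (hp : f ∉ H0 (twist D p q (a + 1) b))
    (hq : f ∉ H0 (twist D p q a (b + 1))) : HasExactOrders D p q a b f := by
  have h0 : f ≠ 0 := by
    rintro rfl
    exact hp (zero_mem _)
  rw [mem_H0_twist hpq h0] at hp hq
  obtain ⟨h1, h2, h3⟩ := (mem_H0_twist hpq h0).1 h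
  refine ⟨h0, h, ?_, ?_⟩
  · by_contra hne
    exact hp ⟨h1, by omega, h3⟩
  · by_contra hne
    exact hq ⟨h1, h2, by omega⟩

/-- A vector space is not the union of two proper subspaces. -/
theorem exists_notMem_of_lt {V W W' : Submodule F K} (h : W < V) (h' : W' < V) :
    ∃ f ∈ V, f ∉ W ∧ f ∉ W' := by
  obtain ⟨a, ha, haW⟩ := SetLike.exists_of_lt h
  obtain ⟨b, hb, hbW⟩ := SetLike.exists_of_lt h'
  by_cases h1 : a ∈ W'
  · by_cases h2 : b ∈ W
    · exact ⟨a + b, add_mem ha hb, fun h => haW ((Submodule.add_mem_iff_left W h2).1 h),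
        fun h => hbW ((Submodule.add_mem_iff_right W' h1).1 h)⟩
    · exact ⟨b, hb, h2, hbW⟩
  · exact ⟨a, ha, haW, h1⟩

variable [GenusOne F K] [IsAlgClosed F]

theorem finrank_H0_le_one {D : Divisor F K} (hD : D.degree ≤ 1) : Module.finrank F (H0 D) ≤ 1 := by
  rcases lt_trichotomy D.degree 0 with h | h | h
  · rw [H0_eq_bot_of_degree_neg h]
    simp
  · exact finrank_H0_le_one_of_degree_eq_zero h
  · exact finrank_H0_le_one_of_degree_eq_one (by omega)

omit [GenusOne F K] [IsAlgClosed F] in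
theorem twist_mem_principalDivisors_iff {D : Divisor F K} {p q : Point F K} {a b : ℤ}
    (h : a + b = D.degree) :
    twist D p q a b ∈ principalDivisors F K ↔ b ∈ markedClass D p q := by
  rw [markedClass, Set.mem_ofPred_eq, show a = D.degree - b by omega]

theorem exists_hasExactOrders_of_degree_eq {D : Divisor F K} {p q : Point F K} (hpq : p ≠ q)
    {a b : ℤ} (hd : D.degree = a + b) (hb : b ∈ markedClass D p q) :
    ∃ f, HasExactOrders D p q a b f := by
  obtain ⟨-, f, hf, h0⟩ := mem_principalDivisors_iff.1
    ((twist_mem_principalDivisors_iff hd.symm).2 hb)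
  refine ⟨f, hasExactOrders_of_notMem hpq hf (fun h => ?_) fun h => ?_⟩ <;>
  · have := degree_nonneg_of_mem_H0 h h0
    rw [degree_twist] at this
    omega

theorem H0_twist_eq_bot {D : Divisor F K} {p q : Point F K} {a b : ℤ} (hd : D.degree = a + b)
    (hb : b ∉ markedClass D p q) : H0 (twist D p q a b) = ⊥ := by
  rcases H0_eq_bot_or (twist D p q a b) with h | h
  · exact h
  · refine absurd ((twist_mem_principalDivisors_iff hd.symm).1 ?_) hb
    exact mem_principalDivisors_iff.2 ⟨by rw [degree_twist]; omega, h⟩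

/-- The twist has degree one, so it has a section. Extra vanishing at `p` would make `b` marked, and
extra vanishing at `q` would make `b + 1` marked. -/
theorem exists_hasExactOrders_of_degree_eq_add_one {D : Divisor F K} {p q : Point F K}
    (hpq : p ≠ q) {a b : ℤ} (hd : D.degree = a + b + 1) (hb : b ∉ markedClass D p q)
    (hb' : b + 1 ∉ markedClass D p q) : ∃ f, HasExactOrders D p q a b f := by
  obtain ⟨f, hf, h0⟩ := exists_mem_H0_of_degree_pos (D := twist D p q a b)
    (by rw [degree_twist]; omega)
  refine ⟨f, hasExactOrders_of_notMem hpq hf (fun h => ?_) fun h => ?_⟩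
  · rw [H0_twist_eq_bot (by omega) hb] at h
    exact h0 h
  · rw [H0_twist_eq_bot (by omega) hb'] at h
    exact h0 h

/-- A line bundle of degree two has no base points, since `h⁰` drops from 2 to 1 on subtracting a
point. -/
theorem exists_hasExactOrders_of_degree_eq_add_two {D : Divisor F K} {p q : Point F K}
    (hpq : p ≠ q) {a b : ℤ} (hd : D.degree = a + b + 2) : ∃ f, HasExactOrders D p q a b f := by
  have h2 : (Module.finrank F (H0 (twist D p q a b)) : ℤ) = 2 := by
    rw [finrank_H0_of_degree_pos] <;> rw [degree_twist] <;> omega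
  have hlt : ∀ x, H0 (twist D p q a b - Finsupp.single x 1) < H0 (twist D p q a b) := fun x => by
    refine lt_of_le_of_ne (H0_sub_single_le _ _) fun h => ?_
    have := finrank_H0_le_one (D := twist D p q a b - Finsupp.single x 1)
      (by rw [Divisor.degree_sub, Divisor.degree_single, degree_twist]; omega)
    rw [h] at this
    omega
  obtain ⟨f, hf, h1, h3⟩ := exists_notMem_of_lt (hlt p) (hlt q)
  exact ⟨f, hasExactOrders_of_notMem hpq hf (by rwa [twist_add_one_left])
    (by rwa [twist_add_one_right])⟩

end Twist

/-! ### Dimension counts from ramification -/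

section Ramification

variable {F K : Type*} [Field F] [Field K] [Algebra F K] {r : ℕ}

theorem HasRamification.exists_basis {D : Divisor F K} {V : Submodule F K} {x : Point F K}
    {γ : Fin (r + 1) → ℤ} (h : HasRamification D V x γ) :
    ∃ e : Fin (r + 1) → K, ∀ i, e i ∈ V ∧ e i ≠ 0 ∧ x.ord (e i) + D x = γ i + (i : ℕ) := by
  have : ∀ i : Fin (r + 1), ∃ s ∈ V, s ≠ 0 ∧ γ i + (i : ℕ) = x.ord s + D x := fun i => by
    have : γ i + ((i : ℕ) : ℤ) ∈ vanishingOrders D V x := h.2 ▸ Set.mem_range_self i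
    exact this
  choose e he using this
  exact ⟨e, fun i => ⟨(he i).1, (he i).2.1, (he i).2.2.symm⟩⟩

theorem HasRamification.le_finrank {D : Divisor F K} {V : Submodule F K} [FiniteDimensional F V]
    {x : Point F K} {γ : Fin (r + 1) → ℤ} (h : HasRamification D V x γ) (k : Fin (r + 1)) :
    r + 1 - (k : ℕ) ≤ Module.finrank F
      ↥(V ⊓ sectionsOn {x} (D - Finsupp.single x (γ k + (k : ℕ)))) := by
  obtain ⟨e, he⟩ := h.exists_basis
  have hinj : Function.Injective fun i => x.ord (e i) := fun i j hij => by
    have h1 := (he i).2.2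
    have h2 := (he j).2.2
    dsimp only at hij
    exact h.1.injective (by omega)
  have hli := x.linearIndependent_of_ord (fun i => (he i).2.1) hinj
  have hmem : ∀ i : Finset.Ici k, e i ∈
      V ⊓ sectionsOn {x} (D - Finsupp.single x (γ k + (k : ℕ))) := by
    rintro ⟨i, hi⟩
    refine ⟨(he i).1, ?_⟩
    rintro y rfl
    rw [y.v_le_exp_iff (he i).2.1, Finsupp.sub_apply, Finsupp.single_eq_same]
    have h1 := (he i).2.2
    have h2 := h.1.monotone (Finset.mem_Ici.1 hi)
    omega
  have hli' : LinearIndependent F fun i : Finset.Ici k => (⟨e i, hmem i⟩ :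
      ↥(V ⊓ sectionsOn {x} (D - Finsupp.single x (γ k + (k : ℕ))))) :=
    LinearIndependent.of_comp (Submodule.subtype _)
      (hli.comp (fun i : Finset.Ici k => (i : Fin (r + 1))) Subtype.val_injective)
  have := hli'.fintype_card_le_finrank
  rwa [Fintype.card_coe, Fin.card_Ici] at this

/-- With distinct orders at `x`, a nonzero combination has the order of one of its terms. The
permutation `τ` is needed because a basis sorted by order at one marked point need not be sorted at
the other. -/
theorem hasRamification_span {D : Divisor F K} {x : Point F K} {γ : Fin (r + 1) → ℤ}
    (hγ : StrictMono fun i : Fin (r + 1) => γ i + ((i : ℕ) : ℤ)) {f : Fin (r + 1) → K}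
    (hf : ∀ i, f i ≠ 0) {τ : Fin (r + 1) → Fin (r + 1)} (hτ : Function.Bijective τ)
    (h : ∀ i, x.ord (f i) + D x = γ (τ i) + (τ i : ℕ)) :
    HasRamification D (Submodule.span F (Set.range f)) x γ := by
  have hinj : Function.Injective fun i => x.ord (f i) := fun i j hij => by
    have h1 := h i
    have h2 := h j
    dsimp only at hij
    exact hτ.1 (hγ.injective (by omega))
  refine ⟨hγ, Set.ext fun n => ⟨?_, ?_⟩⟩
  · rintro ⟨i, rfl⟩
    obtain ⟨j, rfl⟩ := hτ.2 i
    exact ⟨f j, Submodule.subset_span ⟨j, rfl⟩, hf j, (h j).symm⟩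
  · rintro ⟨s, hs, h0, rfl⟩
    obtain ⟨c, rfl⟩ := (Submodule.mem_span_range_iff_exists_fun F).1 hs
    have hc : c ≠ 0 := by
      rintro rfl
      simp at h0
    obtain ⟨i, -, -, hi⟩ := x.exists_ord_sum_eq hf hinj hc
    exact ⟨τ i, by rw [hi, h i]⟩

theorem strictMono_add_val {γ : Fin (r + 1) → ℤ} (h : Monotone γ) :
    StrictMono fun i : Fin (r + 1) => γ i + ((i : ℕ) : ℤ) := fun i j hij => by
  have h1 := h hij.le
  have h2 : (i : ℕ) < j := hij
  dsimp only
  omega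

theorem monotone_negSeq {α : Fin (r + 1) → ℤ} (h : Monotone α) : Monotone (negSeq α) :=
  fun _ _ hij => neg_le_neg (h (Fin.rev_le_rev.2 hij))

/-- The orders at `p` are indexed backwards, so that `α i` and `β i` carry the same index at the two
points. -/
theorem negSeq_rev_add (α : Fin (r + 1) → ℤ) (i : Fin (r + 1)) :
    negSeq α i.rev + (i.rev : ℕ) = r - α i - (i : ℕ) := by
  rw [negSeq, Fin.rev_rev, Fin.val_rev]
  have := i.2
  omega

variable {p q : Point F K} {α β : Fin (r + 1) → ℤ} {D : Divisor F K} {V : Submodule F K}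

theorem IsExactSeries.finiteDimensional (h : IsExactSeries p q α β D V) :
    FiniteDimensional F V := by
  refine Module.finite_of_finrank_pos ?_
  rw [h.finrank_eq]
  omega

/-- Sections that vanish simultaneously at both points. -/
theorem IsExactSeries.le_finrank_inf (hpq : p ≠ q) (h : IsExactSeries p q α β D V)
    (i j : Fin (r + 1)) :
    (j : ℕ) + 1 ≤ Module.finrank F
      ↥(V ⊓ H0 (twist D p q (r - α j - (j : ℕ)) (β i + (i : ℕ)))) + i := by
  have := h.finiteDimensional
  have h1 := h.ram_p.le_finrank j.rev
  have h2 := h.ram_q.le_finrank i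
  rw [negSeq_rev_add, Fin.val_rev] at h1
  -- Inside `V`, of dimension `r + 1`, `A` has dimension at least `j + 1` and `B` at least `r + 1 -
  -- i`.
  set A := V ⊓ sectionsOn {p} (D - Finsupp.single p (r - α j - (j : ℕ)))
  set B := V ⊓ sectionsOn {q} (D - Finsupp.single q (β i + (i : ℕ)))
  have h3 := Submodule.finrank_sup_add_finrank_inf_eq A B
  have h4 : Module.finrank F ↥(A ⊔ B) ≤ r + 1 := by
    rw [← h.finrank_eq]
    exact Submodule.finrank_mono (sup_le inf_le_left inf_le_left)
  have h5 : Module.finrank F ↥(A ⊓ B) ≤ Module.finrank F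
      ↥(V ⊓ H0 (twist D p q (r - α j - (j : ℕ)) (β i + (i : ℕ)))) := by
    refine Submodule.finrank_mono ?_
    rintro f ⟨⟨hV, hA⟩, -, hB⟩
    refine ⟨hV, ?_⟩
    by_cases h0 : f = 0
    · rw [h0]; exact zero_mem _
    refine (mem_H0_twist hpq h0).2 ⟨h.regular hV, ?_, ?_⟩
    · have := hA p rfl
      rw [p.v_le_exp_iff h0, Finsupp.sub_apply, Finsupp.single_eq_same] at this
      omega
    · have := hB q rfl
      rw [q.v_le_exp_iff h0, Finsupp.sub_apply, Finsupp.single_eq_same] at this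
      omega
  have := i.2
  have := j.2
  omega

theorem IsExactSeries.exists_mem (hpq : p ≠ q) (h : IsExactSeries p q α β D V)
    (i : Fin (r + 1)) :
    ∃ s ∈ V, s ∈ H0 (twist D p q (r - α i - (i : ℕ)) (β i + (i : ℕ))) ∧ s ≠ 0 := by
  have := h.le_finrank_inf hpq i i
  by_contra! hn
  have hbot : V ⊓ H0 (twist D p q (r - α i - (i : ℕ)) (β i + (i : ℕ))) = ⊥ :=
    (Submodule.eq_bot_iff _).2 fun s hs => hn s hs.1 hs.2
  rw [hbot, finrank_bot] at this
  omega

/-- The sections with prescribed vanishing lie in `V` when the dimension count forces it. -/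
theorem IsExactSeries.H0_twist_le (hpq : p ≠ q) (h : IsExactSeries p q α β D V)
    {i j : Fin (r + 1)} [FiniteDimensional F
      (H0 (twist D p q (r - α j - (j : ℕ)) (β i + (i : ℕ))))] (hd : Module.finrank F
      (H0 (twist D p q (r - α j - (j : ℕ)) (β i + (i : ℕ)))) + i ≤ j + 1) :
    H0 (twist D p q (r - α j - (j : ℕ)) (β i + (i : ℕ))) ≤ V := by
  have h1 := h.le_finrank_inf hpq i j
  rw [← inf_eq_right]
  exact Submodule.eq_of_le_of_finrank_le inf_le_right (by omega)

end Ramification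

/-! ### Which line bundles carry a series, and the case `α < β` -/

section Classification

variable {F K : Type*} [Field F] [Field K] [Algebra F K]

theorem twist_sub_twist (D : Divisor F K) (p q : Point F K) (k l : ℤ) :
    twist D p q (D.degree - k) k - twist D p q (D.degree - l) l =
      (k - l) • (Finsupp.single p 1 - Finsupp.single q 1) := by
  simp only [twist, smul_sub, Finsupp.smul_single, smul_eq_mul, mul_one, Finsupp.single_sub]
  abel

theorem mem_markedClass_iff {D : Divisor F K} {p q : Point F K} {k l : ℤ}
    (hk : k ∈ markedClass D p q) :
    l ∈ markedClass D p q ↔ (torsionOrder p q : ℤ) ∣ l - k := by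
  rw [torsionOrder, addOrderOf_dvd_iff_zsmul_eq_zero, ← QuotientAddGroup.mk_zsmul,
    QuotientAddGroup.eq_zero_iff, ← twist_sub_twist D]
  refine ⟨fun h => AddSubgroup.sub_mem _ h hk, fun h => ?_⟩
  have := AddSubgroup.add_mem _ h hk
  rwa [sub_add_cancel] at this

theorem markedClass_eq {D : Divisor F K} {p q : Point F K} {k : ℤ}
    (hk : k ∈ markedClass D p q) :
    markedClass D p q = {l | ∃ j : ℤ, l = k + torsionOrder p q * j} := by
  ext l
  rw [mem_markedClass_iff hk, Set.mem_ofPred_eq]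
  exact exists_congr fun j => by constructor <;> intro h <;> linarith

theorem IsExactSeries.seriesIso_map {r : ℕ} {p q : Point F K} {α β : Fin (r + 1) → ℤ}
    {D D' : Divisor F K} {V : Submodule F K} (h : IsExactSeries p q α β D V) {f : K}
    (hf : IsDivisorOf (D - D') f) (hdeg : D'.degree = D.degree) :
    IsExactSeries p q α β D' (V.map (LinearMap.mulLeft F f)) := by
  have hinj : Function.Injective (LinearMap.mulLeft F f) := mul_right_injective₀ hf.1
  have hord : ∀ (x : Point F K) {s : K}, s ≠ 0 → x.ord (f * s) + D' x = x.ord s + D x :=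
    fun x s hs => by
      have := hf.2 x
      rw [Finsupp.sub_apply] at this
      rw [x.ord_mul hf.1 hs]
      omega
  have hvan : ∀ x, vanishingOrders D' (V.map (LinearMap.mulLeft F f)) x =
      vanishingOrders D V x := by
    intro x
    ext n
    constructor
    · rintro ⟨_, ⟨s, hs, rfl⟩, h0, rfl⟩
      have hs0 : s ≠ 0 := right_ne_zero_of_mul h0
      exact ⟨s, hs, hs0, hord x hs0⟩
    · rintro ⟨s, hs, h0, rfl⟩
      exact ⟨f * s, ⟨s, hs, rfl⟩, mul_ne_zero hf.1 h0, (hord x h0).symm⟩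
  refine ⟨⟨hdeg.trans h.degree_eq, ?_, ?_⟩, ⟨h.ram_p.1, ?_⟩, ⟨h.ram_q.1, ?_⟩⟩
  · rw [← (Submodule.equivMapOfInjective _ hinj V).finrank_eq, h.finrank_eq]
  · rintro _ ⟨s, hs, rfl⟩ x hx
    by_cases h0 : s = 0
    · simp [h0]
    · have := h.regular hs x hx
      rw [x.v_le_exp_iff h0] at this
      rw [LinearMap.mulLeft_apply, x.v_le_exp_iff (mul_ne_zero hf.1 h0), hord x h0]
      exact this
  · rw [hvan, h.ram_p.2]
  · rw [hvan, h.ram_q.2]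

variable [GenusOne F K] [IsAlgClosed F]

/-- Two consecutive elements would make `p` and `q` linearly equivalent. -/
theorem add_one_notMem_markedClass {D : Divisor F K} {p q : Point F K} (hpq : p ≠ q) (k : ℤ)
    (hk : k ∈ markedClass D p q) : k + 1 ∉ markedClass D p q := fun h => by
  have := (principalDivisors F K).sub_mem h hk
  rw [twist_sub_twist, add_sub_cancel_left, one_smul] at this
  exact hpq (eq_of_single_sub_single_mem this)

theorem isProgression_markedClass {D : Divisor F K} {p q : Point F K} (hpq : p ≠ q) {k : ℤ}
    (hk : k ∈ markedClass D p q) : IsProgression (torsionOrder p q) (markedClass D p q) := by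
  refine ⟨?_, k, markedClass_eq hk⟩
  have h1 : torsionOrder p q ≠ 1 := fun h => by
    refine add_one_notMem_markedClass hpq k hk ((mem_markedClass_iff hk).2 ?_)
    rw [h]
    simp
  omega

variable {r : ℕ} {p q : Point F K} {α β : Fin (r + 1) → ℤ} {D : Divisor F K}
  {V : Submodule F K}

theorem IsExactSeries.H0_twist_le_of_degree_le (hpq : p ≠ q) (h : IsExactSeries p q α β D V)
    {i : Fin (r + 1)} (hi : D.degree ≤ (r - α i - (i : ℕ)) + (β i + (i : ℕ)) + 1) :
    H0 (twist D p q (r - α i - (i : ℕ)) (β i + (i : ℕ))) ≤ V := by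
  refine h.H0_twist_le hpq ?_
  have := finrank_H0_le_one (D := twist D p q (r - α i - (i : ℕ)) (β i + (i : ℕ)))
    (by rw [degree_twist]; omega)
  omega

theorem IsExactSeries.isAdmissible (hpq : p ≠ q) (hα : Monotone α) (hβ : Monotone β)
    (hαβ : α ≤ β) (h : IsExactSeries p q α β D V) :
    IsAdmissible (markedClass D p q) α β := by
  have hd := h.degree_eq
  have hstep : ∀ i, β i = α i ∨ β i = α i + 1 ∧ α i + (i : ℕ) + 1 ∈ markedClass D p q := by
    intro i
    obtain ⟨s, -, hs, h0⟩ := h.exists_mem hpq i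
    have h1 := degree_nonneg_of_mem_H0 hs h0
    rw [degree_twist] at h1
    have h2 : α i ≤ β i := hαβ i
    rcases eq_or_ne (β i) (α i) with heq | hne
    · exact .inl heq
    · have h3 : β i = α i + 1 := by omega
      refine .inr ⟨h3, (twist_mem_principalDivisors_iff
        (a := r - α i - (i : ℕ)) (by omega)).1 (mem_principalDivisors_iff.2
          ⟨by rw [degree_twist]; omega, s, ?_, h0⟩)⟩
      rwa [show α i + ((i : ℕ) : ℤ) + 1 = β i + (i : ℕ) by omega]
  -- When `β i = α i` the twist has degree one and its sections all lie in `V`. If `b` is marked,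
  -- one of them has exact orders `a` and `b`, and these must occur in the ramification of `V`.
  have hmem : ∀ i, β i = α i → ∀ a b : ℤ, r - α i - (i : ℕ) ≤ a → β i + (i : ℕ) ≤ b →
      a + b = D.degree → b ∈ markedClass D p q →
      ∃ s ∈ V, s ≠ 0 ∧ p.ord s + D p = a ∧ q.ord s + D q = b := by
    intro i hi a b ha hb hab hbm
    obtain ⟨f, hf⟩ := exists_hasExactOrders_of_degree_eq hpq hab.symm hbm
    refine ⟨f, h.H0_twist_le_of_degree_le (i := i) hpq (by omega) ?_, hf.ne_zero, hf.ord_p, hf.ord_q⟩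
    have := (mem_H0_twist hpq hf.ne_zero).1 hf.mem
    exact (mem_H0_twist hpq hf.ne_zero).2 ⟨this.1, by omega, by omega⟩
  refine ⟨hstep, fun i hi hm => ?_, fun i hi hm => ?_⟩
  · obtain ⟨s, hsV, h0, -, hq⟩ := hmem i hi (r - α i - (i : ℕ)) (α i + (i : ℕ) + 1) le_rfl
      (by omega) (by omega) hm
    obtain ⟨j, hj⟩ : α i + ((i : ℕ) : ℤ) + 1 ∈ Set.range fun i : Fin (r + 1) =>
        β i + ((i : ℕ) : ℤ) := by
      rw [h.ram_q.2]
      exact ⟨s, hsV, h0, hq.symm⟩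
    dsimp only at hj
    -- The order at `q` is one more than `β i + i`, so by monotonicity it can only be that of `j = i
    -- + 1` with `β j = β i`; then `α j` is squeezed between `α i` and `β j`.
    have hij : i < j := by
      by_contra! hle
      have h1 := hβ hle
      have h2 : (j : ℕ) ≤ i := hle
      omega
    have h1 := hβ hij.le
    have h2 := hα hij.le
    have h3 : (i : ℕ) < j := hij
    have h4 : α j ≤ β j := hαβ j
    exact ⟨j, by omega, by omega, by omega⟩
  · obtain ⟨s, hsV, h0, hp, -⟩ := hmem i hi (r + 1 - α i - (i : ℕ)) (α i + (i : ℕ))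
      (by omega) (by omega) (by omega) hm
    obtain ⟨j', hj⟩ : r + 1 - α i - ((i : ℕ) : ℤ) ∈ Set.range fun i : Fin (r + 1) =>
        negSeq α i + ((i : ℕ) : ℤ) := by
      rw [h.ram_p.2]
      exact ⟨s, hsV, h0, hp.symm⟩
    obtain ⟨j, rfl⟩ := Fin.rev_surjective j'
    dsimp only at hj
    rw [negSeq_rev_add] at hj
    have hij : j < i := by
      by_contra! hle
      have h1 := hα hle
      have h2 : (i : ℕ) ≤ j := hle
      omega
    have h1 := hβ hij.le
    have h2 := hα hij.le
    have h3 : (j : ℕ) < i := hij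
    have h4 : α j ≤ β j := hαβ j
    exact ⟨j, by omega, by omega, by omega⟩

omit [GenusOne F K] [IsAlgClosed F] in
theorem linearIndependent_of_hasExactOrders (hβ : Monotone β) {a : Fin (r + 1) → ℤ}
    {f : Fin (r + 1) → K} (hf : ∀ i, HasExactOrders D p q (a i) (β i + (i : ℕ)) (f i)) :
    LinearIndependent F f :=
  q.linearIndependent_of_ord (fun i => (hf i).ne_zero)
    fun i j hij => (strictMono_add_val hβ).injective (by
      have h1 := (hf i).ord_q
      have h2 := (hf j).ord_q
      dsimp only at hij
      omega)

omit [GenusOne F K] [IsAlgClosed F] in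
theorem isExactSeries_span (hpq : p ≠ q) (hα : Monotone α) (hβ : Monotone β)
    (hd : D.degree = r + 1) {σ : Fin (r + 1) → Fin (r + 1)} (hσ : Function.Bijective σ)
    {f : Fin (r + 1) → K}
    (hf : ∀ i, HasExactOrders D p q (r - α (σ i) - (σ i : ℕ)) (β i + (i : ℕ)) (f i)) :
    IsExactSeries p q α β D (Submodule.span F (Set.range f)) := by
  have hq : HasRamification D (Submodule.span F (Set.range f)) q β :=
    hasRamification_span (strictMono_add_val hβ) (fun i => (hf i).ne_zero)
      Function.bijective_id fun i => (hf i).ord_q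
  have hp : HasRamification D (Submodule.span F (Set.range f)) p (negSeq α) :=
    hasRamification_span (strictMono_add_val (monotone_negSeq hα)) (fun i => (hf i).ne_zero)
      (τ := fun i => (σ i).rev) (Fin.rev_bijective.comp hσ) fun i => by
        rw [negSeq_rev_add, (hf i).ord_p]
  have hli := linearIndependent_of_hasExactOrders hβ hf
  have hfin : Module.finrank F (Submodule.span F (Set.range f)) = r + 1 := by
    rw [finrank_span_eq_card hli, Fintype.card_fin]
  refine ⟨⟨hd, hfin, ?_⟩, hp, hq⟩
  rw [Submodule.span_le]
  rintro _ ⟨i, rfl⟩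
  exact ((mem_H0_twist hpq (hf i).ne_zero).1 (hf i).mem).1

/-- The space of sections with the given ramification is unique, and it exists, when the
conditions on `α` and `β` hold for the class of `D`. -/
theorem exists_unique_isExactSeries (hpq : p ≠ q) (hα : Monotone α) (hβ : Monotone β)
    (hd : D.degree = r + 1) (h : IsAdmissible (markedClass D p q) α β) :
    ∃ V, IsExactSeries p q α β D V ∧ ∀ V', IsExactSeries p q α β D V' → V' = V := by
  obtain ⟨σ, hσ, hmatch⟩ := h.exists_matching fun k hk => add_one_notMem_markedClass hpq k hk
  have hex : ∀ i, ∃ f, HasExactOrders D p q (r - α (σ i) - (σ i : ℕ)) (β i + (i : ℕ)) f ∧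
      ∀ V', IsExactSeries p q α β D V' → f ∈ V' := by
    intro i
    -- For `σ i = i + 1` the twist has degree two, and the bound `σ i + 1 - i = 2` puts all its
    -- sections in `V'`. For `σ i = i - 1` it has degree zero, inside the degree-one twist at `(i,
    -- i)`. For `σ i = i` it has degree one or zero according as `β i = α i` or `β i = α i + 1`.
    rcases hmatch i with ⟨hi, hm, hs, hσα⟩ | ⟨hi, hm, hs, hσα⟩ | ⟨hs, hn⟩
    · obtain ⟨f, hf⟩ := exists_hasExactOrders_of_degree_eq_add_two (D := D) hpq
        (a := r - α (σ i) - (σ i : ℕ)) (b := β i + (i : ℕ)) (by omega)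
      refine ⟨f, hf, fun V' hV' => hV'.H0_twist_le hpq ?_ hf.mem⟩
      have : (Module.finrank F
          (H0 (twist D p q (r - α (σ i) - (σ i : ℕ)) (β i + (i : ℕ)))) : ℤ) = 2 := by
        rw [finrank_H0_of_degree_pos] <;> rw [degree_twist] <;> omega
      omega
    · obtain ⟨f, hf⟩ := exists_hasExactOrders_of_degree_eq (D := D) hpq
        (a := r - α (σ i) - (σ i : ℕ)) (b := β i + (i : ℕ)) (by omega) (by rwa [hi])
      refine ⟨f, hf, fun V' hV' => hV'.H0_twist_le_of_degree_le (i := i) hpq (by omega) ?_⟩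
      have := (mem_H0_twist hpq hf.ne_zero).1 hf.mem
      exact (mem_H0_twist hpq hf.ne_zero).2 ⟨this.1, by omega, by omega⟩
    · rw [hs]
      rcases h.step i with hi | ⟨hi, hm⟩
      · obtain ⟨f, hf⟩ := exists_hasExactOrders_of_degree_eq_add_one (D := D) hpq
          (a := r - α i - (i : ℕ)) (b := β i + (i : ℕ)) (by omega)
          (by rw [hi]; exact (hn hi).1) (by rw [hi]; exact (hn hi).2)
        exact ⟨f, hf, fun V' hV' => hV'.H0_twist_le_of_degree_le (i := i) hpq (by omega) hf.mem⟩
      · obtain ⟨f, hf⟩ := exists_hasExactOrders_of_degree_eq (D := D) hpq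
          (a := r - α i - (i : ℕ)) (b := β i + (i : ℕ)) (by omega)
          (by rwa [show β i + ((i : ℕ) : ℤ) = α i + (i : ℕ) + 1 by omega])
        exact ⟨f, hf, fun V' hV' => hV'.H0_twist_le_of_degree_le (i := i) hpq (by omega) hf.mem⟩
  choose f hf hfV using hex
  have hspan := isExactSeries_span hpq hα hβ hd hσ hf
  refine ⟨Submodule.span F (Set.range f), hspan, fun V' hV' => ?_⟩
  have := hV'.finiteDimensional
  refine (Submodule.eq_of_le_of_finrank_le ?_ (by rw [hV'.finrank_eq, hspan.finrank_eq])).symm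
  rw [Submodule.span_le]
  rintro _ ⟨i, rfl⟩
  exact hfV i V' hV'

theorem IsExactSeries.eq (hpq : p ≠ q) (hα : Monotone α) (hβ : Monotone β) (hαβ : α ≤ β)
    {V' : Submodule F K} (h : IsExactSeries p q α β D V) (h' : IsExactSeries p q α β D V') :
    V = V' := by
  obtain ⟨W, -, hW⟩ := exists_unique_isExactSeries hpq hα hβ h.degree_eq
    (h.isAdmissible hpq hα hβ hαβ)
  rw [hW V h, hW V' h']

/-- Two series are isomorphic if and only if their line bundles are. -/
theorem seriesIso_iff (hpq : p ≠ q) (hα : Monotone α) (hβ : Monotone β) (hαβ : α ≤ β)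
    {L L' : Divisor F K × Submodule F K} (h : IsExactSeries p q α β L.1 L.2)
    (h' : IsExactSeries p q α β L'.1 L'.2) :
    SeriesIso L L' ↔ L.1 - L'.1 ∈ principalDivisors F K := by
  constructor
  · rintro ⟨f, hf, -⟩
    exact ⟨f, hf⟩
  · rintro ⟨f, hf⟩
    exact ⟨f, hf, h'.eq hpq hα hβ hαβ
      (h.seriesIso_map hf (h'.degree_eq.trans h.degree_eq.symm))⟩

theorem isEmpty_gTilde (hpq : p ≠ q) (hα : Monotone α) (hβ : Monotone β) (hαβ : α < β)
    (hn : ¬ ∃ Λ : Set ℤ, IsProgression (torsionOrder p q) Λ ∧ Linked Λ α β) :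
    IsEmpty (GTilde p q α β) := by
  refine ⟨fun L => ?_⟩
  obtain ⟨⟨⟨D, V⟩, h⟩, -⟩ := Quotient.exists_rep L
  have hadm := h.isAdmissible hpq hα hβ hαβ.le
  obtain ⟨i, hi⟩ := Function.ne_iff.1 hαβ.ne
  rcases hadm.step i with hi' | ⟨-, hm⟩
  · exact hi hi'.symm
  · exact hn ⟨markedClass D p q, isProgression_markedClass hpq hm,
      (isAdmissible_iff_linked hα hβ hαβ.le
        fun k hk => add_one_notMem_markedClass hpq k hk).1 hadm⟩

theorem existsUnique_gTilde (hpq : p ≠ q) (hα : Monotone α) (hβ : Monotone β) (hαβ : α < β)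
    (hl : ∃ Λ : Set ℤ, IsProgression (torsionOrder p q) Λ ∧ Linked Λ α β) :
    ∃ L : GTilde p q α β, ∀ L' : GTilde p q α β, L' = L := by
  obtain ⟨i, hi⟩ := Function.ne_iff.1 hαβ.ne
  obtain ⟨Λ, ⟨hm, n, hn⟩, hlink⟩ := hl
  have hup := congrFun hlink.2.2 i
  have hi' : β i = α i + 1 ∧ α i + (i : ℕ) + 1 ∈ Λ := by
    rw [dispUp] at hup
    split_ifs at hup with hc
    · exact ⟨hup, hc.2⟩
    · exact absurd hup.symm hi
  set k := α i + ((i : ℕ) : ℤ) + 1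
  -- The moved entry `i` forces `k` into the marked class, and this determines the line bundle up to
  -- isomorphism.
  set D : Divisor F K := Finsupp.single p (r + 1 - k) + Finsupp.single q k with hD
  have hd : D.degree = r + 1 := by
    rw [hD, Divisor.degree_add, Divisor.degree_single, Divisor.degree_single]; ring
  have hk : k ∈ markedClass D p q := by
    have : twist D p q (D.degree - k) k = 0 := by
      rw [hd, twist, hD]; abel
    rw [markedClass, Set.mem_ofPred_eq, this]
    exact zero_mem _
  have hΛ : markedClass D p q = Λ := by
    rw [markedClass_eq hk, hn]
    have hk' := hi'.2
    rw [hn] at hk'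
    obtain ⟨j, hj⟩ := hk'
    ext l
    constructor
    · rintro ⟨j', rfl⟩
      exact ⟨j + j', by rw [hj]; ring⟩
    · rintro ⟨j', rfl⟩
      exact ⟨j' - j, by rw [hj]; ring⟩
  have hadm : IsAdmissible (markedClass D p q) α β :=
    (isAdmissible_iff_linked hα hβ hαβ.le
      fun k hk => add_one_notMem_markedClass hpq k hk).2 (hΛ ▸ hlink)
  obtain ⟨V, hV, -⟩ := exists_unique_isExactSeries hpq hα hβ hd hadm
  refine ⟨Quotient.mk _ ⟨(D, V), hV⟩, fun L' => ?_⟩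
  obtain ⟨⟨⟨D', V'⟩, h⟩, rfl⟩ := Quotient.exists_rep L'
  refine Quotient.sound ((seriesIso_iff hpq hα hβ hαβ.le h hV).2 ?_)
  have hk' : k ∈ markedClass D' p q := by
    rcases (h.isAdmissible hpq hα hβ hαβ.le).step i with h1 | h1
    · exact absurd h1.symm hi
    · exact h1.2
  have := (principalDivisors F K).sub_mem hk' hk
  rwa [hd, show D'.degree = r + 1 from h.degree_eq, twist, twist, sub_sub_sub_cancel_right,
    sub_sub_sub_cancel_right] at this

end Classification

/-! ### A criterion for dimension one -/

section Topology

/-- A space of dimension one: points are closed, and the open sets that meet a fixed cofinite set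
are cofinite. -/
theorem topologicalKrullDim_eq_one {X : Type*} [TopologicalSpace X]
    (hpt : ∀ x : X, IsClosed ({x} : Set X)) {G : Set X} (hG : G.Infinite) (hGc : Gᶜ.Finite)
    (hopen : ∀ U : Set X, IsOpen U → (U ∩ G).Nonempty → Uᶜ.Finite) :
    topologicalKrullDim X = 1 := by
  have hfin : ∀ S : Set X, S.Finite → IsClosed S := fun S hS => by
    rw [← Set.biUnion_of_singleton S]
    exact hS.isClosed_biUnion fun x _ => hpt x
  have hirr : IsIrreducible G := by
    refine ⟨hG.nonempty, fun U V hU hV hUG hVG => ?_⟩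
    have h1 := hopen U hU (by rwa [Set.inter_comm])
    have h2 := hopen V hV (by rwa [Set.inter_comm])
    obtain ⟨x, hx, hx'⟩ := hG.exists_notMem_finite (h1.union h2)
    simp only [Set.mem_union, Set.mem_compl_iff, not_or, not_not] at hx'
    exact ⟨x, hx, hx'.1, hx'.2⟩
  refine le_antisymm ?_ ?_
  · refine Order.krullDim_le_one_iff.2 fun Z => ?_
    by_contra! h
    rw [not_isMin_iff, not_isMax_iff] at h
    obtain ⟨⟨Y, hY⟩, ⟨W, hW⟩⟩ := h
    have hY' : (Y : Set X) ⊂ Z := hY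
    have hW' : (Z : Set X) ⊂ W := hW
    have hYc : IsClosed (Y : Set X) := Y.isClosed
    have hZc : IsClosed (Z : Set X) := Z.isClosed
    -- In a chain `Y ⊂ Z ⊂ W` of irreducible closed sets, a finite `Z` splits into the closed sets
    -- `Y` and `Z \ Y`. An infinite `Z` contains `G`, so `W` is covered by `Z` and the finite closed
    -- set `Gᶜ`.
    by_cases hZ : (Z : Set X).Finite
    · rcases isPreirreducible_iff_isClosed_union_isClosed.1 Z.isIrreducible.isPreirreducible
        Y (Z \ Y) hYc (hfin _ (hZ.subset Set.sdiff_subset)) (by simp) with h1 | h1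
      · exact hY'.2 h1
      · obtain ⟨y, hy⟩ := Y.isIrreducible.nonempty
        exact (h1 (hY'.1 hy)).2 hy
    · have hGZ : G ⊆ Z := by
        by_contra hn
        obtain ⟨x, hx, hxZ⟩ := Set.not_subset.1 hn
        have := hopen (Z : Set X)ᶜ hZc.isOpen_compl ⟨x, hxZ, hx⟩
        rw [compl_compl] at this
        exact hZ this
      rcases isPreirreducible_iff_isClosed_union_isClosed.1 W.isIrreducible.isPreirreducible
        Z Gᶜ hZc (hfin _ hGc) (fun x _ => by
          by_cases hx : x ∈ G
          · exact .inl (hGZ hx)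
          · exact .inr hx) with h1 | h1
      · exact hW'.2 h1
      · obtain ⟨x, hx⟩ := hG.nonempty
        exact h1 (hW'.1 (hGZ hx)) hx
  · obtain ⟨x, hx⟩ := hG.nonempty
    refine Order.one_le_krullDim_iff.2 ⟨⟨{x}, isIrreducible_singleton, hpt x⟩,
      ⟨closure G, hirr.closure, isClosed_closure⟩, ?_⟩
    change ({x} : Set X) ⊂ closure G
    refine ⟨Set.singleton_subset_iff.2 (subset_closure hx), fun h => ?_⟩
    exact hG ((Set.finite_singleton x).subset (subset_closure.trans h))

end Topology

/-! ### Values of functions and congruences of polynomials at a point -/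

section Values

variable {F K : Type*} [Field F] [Field K] [Algebra F K]

/-- The value at `x` of a rational function regular at `x`. -/
def Point.value (x : Point F K) (f : K) : F :=
  Classical.epsilon fun c => x.v (f - algebraMap F K c) < 1

theorem Point.v_sub_value_lt_one [GenusOne F K] [IsAlgClosed F] (x : Point F K) {f : K}
    (hf : x.v f ≤ 1) : x.v (f - algebraMap F K (x.value f)) < 1 :=
  Classical.epsilon_spec (x.exists_residue hf)

variable (v : Valuation K ℤᵐ⁰)

theorem v_mul_sub_mul_lt_one {a b c d : K} (hb : v b ≤ 1) (hc : v c ≤ 1)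
    (hab : v (a - b) < 1) (hcd : v (c - d) < 1) : v (a * c - b * d) < 1 := by
  rw [show a * c - b * d = (a - b) * c + b * (c - d) by ring]
  refine Valuation.map_add_lt _ ?_ ?_ <;> rw [map_mul]
  · exact (mul_le_of_le_one_right' hc).trans_lt hab
  · exact (mul_le_of_le_one_left' hb).trans_lt hcd

theorem v_pow_sub_pow_lt_one {a b : K} (ha : v a ≤ 1) (hb : v b ≤ 1) (hab : v (a - b) < 1)
    (n : ℕ) : v (a ^ n - b ^ n) < 1 := by
  induction n with
  | zero => simp
  | succ n ih =>
    rw [pow_succ, pow_succ]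
    exact v_mul_sub_mul_lt_one v (by rw [map_pow]; exact pow_le_one' hb n) ha ih hab

theorem v_prod_sub_prod_lt_one {ι : Type*} (s : Finset ι) {a b : ι → K} (ha : ∀ i, v (a i) ≤ 1)
    (hb : ∀ i, v (b i) ≤ 1) (hab : ∀ i, v (a i - b i) < 1) :
    v (∏ i ∈ s, a i - ∏ i ∈ s, b i) < 1 := by
  classical
  induction s using Finset.induction_on with
  | empty => simp
  | insert i s hi ih =>
    rw [Finset.prod_insert hi, Finset.prod_insert hi]
    refine v_mul_sub_mul_lt_one v (hb i) ?_ (hab i) ih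
    rw [map_prod]
    exact Finset.prod_le_one' fun j _ => ha j

/-- Congruent arguments give congruent values of a polynomial. -/
theorem v_eval_sub_eval_lt_one {σ : Type*} {P : MvPolynomial σ K} (hP : ∀ c, v (P.coeff c) ≤ 1)
    {a b : σ → K} (ha : ∀ i, v (a i) ≤ 1) (hb : ∀ i, v (b i) ≤ 1)
    (hab : ∀ i, v (a i - b i) < 1) :
    v (MvPolynomial.eval a P - MvPolynomial.eval b P) < 1 := by
  rw [MvPolynomial.eval_eq, MvPolynomial.eval_eq, ← Finset.sum_sub_distrib]
  refine Valuation.map_sum_lt' _ zero_lt_one fun d _ => ?_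
  rw [← mul_sub, map_mul]
  refine (mul_le_of_le_one_left' (hP d)).trans_lt (v_prod_sub_prod_lt_one v _ ?_ ?_ ?_)
  · exact fun i => by rw [map_pow]; exact pow_le_one' (ha i) _
  · exact fun i => by rw [map_pow]; exact pow_le_one' (hb i) _
  · exact fun i => v_pow_sub_pow_lt_one v (ha i) (hb i) (hab i) _

end Values

/-! ### Pencils as algebraic families, and the Zariski topology -/

section Families

variable {F K : Type*} [Field F] [Field K] [Algebra F K]

/-- The member of the pencil spanned by `f` and `g` that vanishes at `x`. -/
def pencilMember (f g : K) (x : Point F K) : K := x.value f • g - x.value g • f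

variable [GenusOne F K] [IsAlgClosed F]

theorem pencilMember_mem {N : Divisor F K} {f g : K} (hf : f ∈ H0 N) (hg : g ∈ H0 N)
    {x : Point F K} (hx : N x = 0) :
    pencilMember f g x ∈ H0 (N - Finsupp.single x 1) := by
  have h1 : x.v f ≤ 1 := by simpa [hx] using mem_H0.1 hf x
  have h2 : x.v g ≤ 1 := by simpa [hx] using mem_H0.1 hg x
  by_cases h0 : pencilMember f g x = 0
  · rw [h0]; exact zero_mem _
  rw [mem_H0_sub_single h0, hx]
  refine ⟨sub_mem (Submodule.smul_mem _ _ hg) (Submodule.smul_mem _ _ hf), ?_⟩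
  have hlt : x.v (pencilMember f g x) < 1 := by
    rw [pencilMember, Algebra.smul_def, Algebra.smul_def,
      mul_comm (algebraMap F K (x.value g)) f]
    refine v_mul_sub_mul_lt_one _ h1 h2 ?_ (x.v_sub_value_lt_one h2)
    rw [Valuation.map_sub_swap]
    exact x.v_sub_value_lt_one h1
  rw [x.v_lt_one_iff h0] at hlt
  omega

/-- If it were zero, independence would make `f` and `g` both vanish at `x`, giving a pencil of
degree one. -/
theorem pencilMember_ne_zero {N : Divisor F K} (hN : N.degree = 2) {f g : K} (hf : f ∈ H0 N)
    (hg : g ∈ H0 N) (hli : LinearIndependent F ![f, g]) {x : Point F K} (hx : N x = 0) :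
    pencilMember f g x ≠ 0 := by
  have h1 : x.v f ≤ 1 := by simpa [hx] using mem_H0.1 hf x
  have h2 : x.v g ≤ 1 := by simpa [hx] using mem_H0.1 hg x
  intro h0
  obtain ⟨hg0, hf0⟩ := LinearIndependent.pair_iff.1 hli (-x.value g) (x.value f) (by
    rw [← h0, pencilMember, neg_smul]; ring)
  have hmem : ∀ s ∈ H0 N, x.v s ≤ 1 → x.value s = 0 → s ∈ H0 (N - Finsupp.single x 1) := by
    intro s hs hv hval
    by_cases hs0 : s = 0
    · rw [hs0]; exact zero_mem _
    have := x.v_sub_value_lt_one hv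
    rw [hval, map_zero, sub_zero, x.v_lt_one_iff hs0] at this
    exact (mem_H0_sub_single hs0).2 ⟨hs, by omega⟩
  have hle : Submodule.span F (Set.range ![f, g]) ≤ H0 (N - Finsupp.single x 1) := by
    rw [Submodule.span_le]
    rintro _ ⟨i, rfl⟩
    fin_cases i
    · exact hmem f hf h1 hf0
    · exact hmem g hg h2 (neg_eq_zero.1 hg0)
  have h3 := Submodule.finrank_mono hle
  rw [finrank_span_eq_card hli, Fintype.card_fin] at h3
  have := finrank_H0_le_one (D := N - Finsupp.single x 1)
    (by rw [Divisor.degree_sub, Divisor.degree_single]; omega)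
  omega

theorem exists_pencil {N : Divisor F K} (hN : N.degree = 2) :
    ∃ f ∈ H0 N, ∃ g ∈ H0 N, LinearIndependent F ![f, g] := by
  have h2 : Module.finrank F (H0 N) = 2 := by
    have := finrank_H0_of_degree_pos (D := N) (by omega)
    omega
  let b := Module.finBasisOfFinrankEq F (H0 N) h2
  refine ⟨b 0, (b 0).2, b 1, (b 1).2, ?_⟩
  have := b.linearIndependent.map' (H0 N).subtype (Submodule.ker_subtype _)
  have heq : ![(b 0 : K), (b 1 : K)] = (H0 N).subtype ∘ b := by
    ext i
    fin_cases i <;> rfl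
  rw [heq]
  exact this

open scoped Topology in
/-- A tuple whose entries are fixed combinations of members of pencils varies algebraically. -/
theorem eventually_mem_of_isOpen_zariski {r : ℕ} {f g : Fin (r + 1) → K}
    (A : Fin (r + 1) → Fin (r + 1) → F) {x₀ : Point F K} (hf : ∀ k, x₀.v (f k) ≤ 1)
    (hg : ∀ k, x₀.v (g k) ≤ 1) {O : Set (Point F K × (Fin (r + 1) → K))}
    (hO : IsOpen[zariski F K r] O)
    (h₀ : (x₀, fun j => ∑ k, A j k • pencilMember (f k) (g k) x₀) ∈ O) :
    ∀ᶠ x in Filter.cofinite, (x, fun j => ∑ k, A j k • pencilMember (f k) (g k) x) ∈ O := by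
  have hreg : ∀ h : K, ∀ᶠ x : Point F K in Filter.cofinite, x.v h ≤ 1 := fun h => by
    rw [Filter.eventually_cofinite]
    simpa using finite_poles h
  change TopologicalSpace.GenerateOpen _ O at hO
  induction hO with
  | basic s hs =>
    obtain ⟨P, rfl⟩ := hs
    obtain ⟨hP, hv⟩ := h₀
    set a : Point F K → Fin (r + 1) × Module.Dual F K → K := fun x j =>
      algebraMap F K (j.2 (∑ k, A j.1 k • pencilMember (f k) (g k) x)) with ha
    -- The coordinate `ℓ(f(x) g - g(x) f)` is the value at `x` of the rational function `f ℓ(g) - g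
    -- ℓ(f)`. So evaluating `P` on the family amounts to reducing at `x` the one function
    -- `MvPolynomial.eval b P`, a unit at `x₀` and hence at almost all points.
    set b : Fin (r + 1) × Module.Dual F K → K := fun j =>
      ∑ k, A j.1 k • (f k * algebraMap F K (j.2 (g k)) - g k * algebraMap F K (j.2 (f k))) with hb
    have key : ∀ x : Point F K, (∀ k, x.v (f k) ≤ 1) → (∀ k, x.v (g k) ≤ 1) →
        (∀ c, x.v (P.coeff c) ≤ 1) →
        x.v (MvPolynomial.eval (a x) P - MvPolynomial.eval b P) < 1 := by
      intro x hfx hgx hPx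
      refine v_eval_sub_eval_lt_one _ hPx (fun j => x.v_algebraMap_le_one _) (fun j => ?_)
        fun j => ?_
      · refine x.v_sum_le _ _ _ fun k _ _ => Valuation.map_sub_le _ ?_ ?_ <;> rw [map_mul]
        · exact mul_le_one' (hfx k) (x.v_algebraMap_le_one _)
        · exact mul_le_one' (hgx k) (x.v_algebraMap_le_one _)
      · have heq : a x j - b j = ∑ k, A j.1 k •
            ((algebraMap F K (x.value (f k)) - f k) * algebraMap F K (j.2 (g k)) -
              (algebraMap F K (x.value (g k)) - g k) * algebraMap F K (j.2 (f k))) := by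
          rw [ha, hb]
          simp only [map_sum, ← Finset.sum_sub_distrib, pencilMember, map_sub, map_smul,
            smul_eq_mul, map_mul]
          simp only [Algebra.smul_def]
          refine Finset.sum_congr rfl fun k _ => ?_
          ring
        rw [heq]
        refine Valuation.map_sum_lt' _ zero_lt_one fun k _ => ?_
        rw [Algebra.smul_def, map_mul]
        refine (mul_le_of_le_one_left' (x.v_algebraMap_le_one _)).trans_lt (Valuation.map_sub_lt _ ?_ ?_) <;>
          rw [map_mul, Valuation.map_sub_swap]
        · exact (mul_le_of_le_one_right' (x.v_algebraMap_le_one _)).trans_lt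
            (x.v_sub_value_lt_one (hfx k))
        · exact (mul_le_of_le_one_right' (x.v_algebraMap_le_one _)).trans_lt
            (x.v_sub_value_lt_one (hgx k))
    have hR : x₀.v (MvPolynomial.eval b P) = 1 := by
      have h1 := key x₀ hf hg hP
      change x₀.v (MvPolynomial.eval (a x₀) P) = 1 at hv
      rw [← Valuation.map_sub_eq_of_lt_left (v := x₀.v) (x := MvPolynomial.eval (a x₀) P)
        (h1.trans_eq hv.symm)] at hv
      rwa [sub_sub_cancel] at hv
    have hR0 : MvPolynomial.eval b P ≠ 0 := by
      intro h
      rw [h, map_zero] at hR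
      exact zero_ne_one hR
    have hRx : ∀ᶠ x : Point F K in Filter.cofinite, x.v (MvPolynomial.eval b P) = 1 :=
      Filter.eventually_cofinite.2 (finite_v_ne_one hR0)
    have hPx : ∀ᶠ x : Point F K in Filter.cofinite, ∀ c, x.v (P.coeff c) ≤ 1 := by
      have := (P.support.finite_toSet.eventually_all
        (p := fun c (x : Point F K) => x.v (P.coeff c) ≤ 1)).2 fun c _ => hreg (P.coeff c)
      filter_upwards [this] with x hx c
      by_cases hc : c ∈ P.support
      · exact hx c hc
      · simp [MvPolynomial.notMem_support_iff.1 hc]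
    filter_upwards [hRx, hPx, Filter.eventually_all.2 fun k => hreg (f k),
      Filter.eventually_all.2 fun k => hreg (g k)] with x h1 h2 h3 h4
    refine ⟨h2, ?_⟩
    have h5 := key x h3 h4 h2
    have h6 := Valuation.map_add_eq_of_lt_right x.v (h5.trans_eq h1.symm)
    rw [sub_add_cancel, h1] at h6
    exact h6
  | univ => exact Filter.Eventually.of_forall fun _ => trivial
  | inter s t _ _ hs ht => exact (hs h₀.1).and (ht h₀.2)
  | sUnion S _ ih =>
    obtain ⟨s, hs, h₀⟩ := h₀
    filter_upwards [ih s hs h₀] with x hx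
    exact ⟨s, hs, hx⟩

open scoped Topology in
theorem isOpen_setOf_fst_ne (r : ℕ) (x₀ : Point F K) :
    IsOpen[zariski F K r] {z | z.1 ≠ x₀} := by
  classical
  let _ := zariski F K r
  refine isOpen_iff_forall_mem_open.2 fun z hz => ?_
  obtain ⟨h, hh, hp⟩ := exists_simple_pole x₀
  have hreg : z.1.v h ≤ 1 := by
    have := mem_H0.1 hh z.1
    rwa [Finsupp.single_apply, if_neg (Ne.symm hz), WithZero.exp_zero] at this
  set c := algebraMap F K (z.1.value h)
  -- `f` takes the value 1 at `z.1` and has a pole at `x₀`, so the basic open set of the constant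
  -- polynomial `f` separates them.
  set f := h - c + 1 with hf
  have h1 : z.1.v f = 1 := by
    rw [hf, Valuation.map_add_eq_of_lt_right, map_one]
    rw [map_one]
    exact z.1.v_sub_value_lt_one hreg
  have h2 : x₀.v f ≠ 1 := by
    have h3 : x₀.v (h - c) = x₀.v h :=
      Valuation.map_sub_eq_of_lt_left _ ((x₀.v_algebraMap_le_one _).trans_lt hp)
    rw [hf, Valuation.map_add_eq_of_lt_left _ (by rw [map_one, h3]; exact hp), h3]
    exact hp.ne'
  refine ⟨_, ?_, TopologicalSpace.isOpen_generateFrom_of_mem ⟨MvPolynomial.C f, rfl⟩, ?_, ?_⟩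
  · rintro w ⟨-, hw⟩ rfl
    rw [evalAt, MvPolynomial.eval_C] at hw
    exact h2 hw
  · intro d
    rw [MvPolynomial.coeff_C]
    split_ifs
    · exact h1.le
    · simp
  · rw [evalAt, MvPolynomial.eval_C]
    exact h1

end Families

/-! ### The case `α = β`: the space is one-dimensional -/

section Dimension

variable {F K : Type*} [Field F] [Field K] [Algebra F K]

theorem span_range_sum_smul {n : ℕ} {A B : Matrix (Fin n) (Fin n) F} (h : B * A = 1)
    (s : Fin n → K) :
    Submodule.span F (Set.range fun j => ∑ k, A j k • s k) = Submodule.span F (Set.range s) := by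
  refine le_antisymm ?_ ?_ <;> rw [Submodule.span_le] <;> rintro _ ⟨j, rfl⟩
  · exact Submodule.sum_mem _ fun k _ => Submodule.smul_mem _ _ (Submodule.subset_span ⟨k, rfl⟩)
  · have : s j = ∑ i, B j i • ∑ k, A i k • s k := by
      simp only [Finset.smul_sum, smul_smul]
      rw [Finset.sum_comm]
      simp only [← Finset.sum_smul, ← Matrix.mul_apply, h, Matrix.one_apply, ite_smul, one_smul,
        zero_smul, Finset.sum_ite_eq, Finset.mem_univ, if_true]
    rw [this]
    exact Submodule.sum_mem _ fun k _ => Submodule.smul_mem _ _ (Submodule.subset_span ⟨k, rfl⟩)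

/-- Two bases of the same space differ by an invertible matrix. -/
theorem exists_matrix_of_span_eq {n : ℕ} {s v : Fin n → K} (hs : LinearIndependent F s)
    (h : Submodule.span F (Set.range v) = Submodule.span F (Set.range s)) :
    ∃ A B : Matrix (Fin n) (Fin n) F, B * A = 1 ∧ v = fun j => ∑ k, A j k • s k := by
  have hA : ∀ j, ∃ c : Fin n → F, ∑ k, c k • s k = v j := fun j =>
    (Submodule.mem_span_range_iff_exists_fun F).1 (h ▸ Submodule.subset_span ⟨j, rfl⟩)
  have hB : ∀ j, ∃ c : Fin n → F, ∑ k, c k • v k = s j := fun j =>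
    (Submodule.mem_span_range_iff_exists_fun F).1 (h ▸ Submodule.subset_span ⟨j, rfl⟩)
  choose A hA using hA
  choose B hB using hB
  refine ⟨A, B, ?_, funext fun j => (hA j).symm⟩
  ext i j
  have h1 : ∑ k, ((Matrix.of B * Matrix.of A) i k -
      (1 : Matrix (Fin n) (Fin n) F) i k) • s k = 0 := by
    simp only [sub_smul, Finset.sum_sub_distrib, Matrix.one_apply, ite_smul, one_smul,
      zero_smul, Finset.sum_ite_eq, Finset.mem_univ, if_true]
    rw [← hB i, sub_eq_zero]
    simp only [← hA, Finset.smul_sum, smul_smul, Matrix.mul_apply, Finset.sum_smul,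
      Matrix.of_apply]
    exact Finset.sum_comm
  exact sub_eq_zero.1 (Fintype.linearIndependent_iff.1 hs _ h1 j)

variable {r : ℕ}

/-- The points `x` for which the vanishing sequences of `O(M - x)` are as small as possible. -/
def genericPoints (p q : Point F K) (α : Fin (r + 1) → ℤ) (M : Divisor F K) : Set (Point F K) :=
  {x | ∀ i, twist M p q (r - α i - (i : ℕ)) (α i + (i : ℕ)) x = 0 ∧
    α i + (i : ℕ) ∉ markedClass (M - Finsupp.single x 1) p q ∧
    α i + (i : ℕ) + 1 ∉ markedClass (M - Finsupp.single x 1) p q}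

theorem degree_sub_single {M : Divisor F K} (hM : M.degree = r + 2) (x : Point F K) :
    Divisor.degree (M - Finsupp.single x 1) = (r : ℤ) + 1 := by
  rw [Divisor.degree_sub, Divisor.degree_single, hM]; ring

theorem twist_sub_single (M : Divisor F K) (p q x : Point F K) (a b : ℤ) :
    twist (M - Finsupp.single x 1) p q a b = twist M p q a b - Finsupp.single x 1 := by
  rw [twist, twist]; abel

variable [GenusOne F K] [IsAlgClosed F] {p q : Point F K} {α : Fin (r + 1) → ℤ}
  {M : Divisor F K}

theorem finite_compl_genericPoints (p q : Point F K) (α : Fin (r + 1) → ℤ) (M : Divisor F K) :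
    (genericPoints p q α M)ᶜ.Finite := by
  -- An element `k` of the marked class determines `O(M - x)`, hence `x`; so each `k` excludes at
  -- most one point.
  have hk : ∀ k : ℤ, ∀ᶠ x : Point F K in Filter.cofinite,
      k ∉ markedClass (M - Finsupp.single x 1) p q := fun k => by
    rw [Filter.eventually_cofinite]
    refine Set.Subsingleton.finite fun x hx y hy => ?_
    simp only [not_not, Set.mem_ofPred_eq] at hx hy
    have := (principalDivisors F K).sub_mem hy hx
    rw [Divisor.degree_sub, Divisor.degree_sub, Divisor.degree_single, Divisor.degree_single,
      twist_sub_single, twist_sub_single, sub_sub_sub_cancel_left] at this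
    exact eq_of_single_sub_single_mem this
  have h : ∀ᶠ x in Filter.cofinite, x ∈ genericPoints p q α M := by
    refine Filter.eventually_all.2 fun i => Filter.Eventually.and ?_ ((hk _).and (hk _))
    rw [Filter.eventually_cofinite]
    exact (twist M p q (r - α i - (i : ℕ)) (α i + (i : ℕ))).hasFiniteSupport
  exact Filter.eventually_cofinite.1 h

theorem hasExactOrders_pencilMember (hpq : p ≠ q) (hM : M.degree = r + 2) {x : Point F K}
    (hx : x ∈ genericPoints p q α M) {i : Fin (r + 1)} {f g : K}
    (hf : f ∈ H0 (twist M p q (r - α i - (i : ℕ)) (α i + (i : ℕ))))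
    (hg : g ∈ H0 (twist M p q (r - α i - (i : ℕ)) (α i + (i : ℕ))))
    (hli : LinearIndependent F ![f, g]) :
    HasExactOrders (M - Finsupp.single x 1) p q (r - α i - (i : ℕ)) (α i + (i : ℕ))
      (pencilMember f g x) := by
  obtain ⟨h0, h1, h2⟩ := hx i
  have hd := degree_sub_single hM x
  have hmem := pencilMember_mem hf hg h0
  have hne := pencilMember_ne_zero (by rw [degree_twist]; omega) hf hg hli h0
  rw [← twist_sub_single] at hmem
  refine hasExactOrders_of_notMem hpq hmem (fun h => ?_) fun h => ?_
  · rw [H0_twist_eq_bot (by omega) h1] at h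
    exact hne h
  · rw [H0_twist_eq_bot (by omega) h2] at h
    exact hne h

theorem toGTilde_eq_iff (hpq : p ≠ q) (hα : Monotone α) (z w : Frames p q α α M) :
    z.toGTilde = w.toGTilde ↔ z.1.1 = w.1.1 := by
  refine (Quotient.eq (r := seriesSetoid p q α α)).trans
    ((seriesIso_iff hpq hα hα le_rfl z.2 w.2).trans ?_)
  rw [sub_sub_sub_cancel_left]
  constructor
  · exact fun h => (eq_of_single_sub_single_mem h).symm
  · intro h
    rw [h, sub_self]
    exact zero_mem _

/-- For each `M`, the frames representing `L` are either none or exactly those over a single point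
of the curve. -/
theorem isClosed_singleton_gTilde (hpq : p ≠ q) (hα : Monotone α) (L : GTilde p q α α) :
    IsClosed ({L} : Set (GTilde p q α α)) := by
  rw [← isOpen_compl_iff]
  refine isOpen_iSup_iff.2 fun M => isOpen_coinduced.2 ?_
  by_cases hL : ∃ w : Frames p q α α M, w.toGTilde = L
  · obtain ⟨w, rfl⟩ := hL
    refine (isOpen_induced_iff (t := zariski F K r)).2 ⟨_, isOpen_setOf_fst_ne r w.1.1, ?_⟩
    ext z
    exact (not_congr (toGTilde_eq_iff hpq hα z w)).symm
  · convert isOpen_univ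
    refine Set.eq_univ_of_forall fun z hz => hL ⟨z, hz⟩

theorem exists_frame_eq (hpq : p ≠ q) (hα : Monotone α) (hM : M.degree = r + 2)
    (L : GTilde p q α α) : ∃ z : Frames p q α α M, z.toGTilde = L := by
  obtain ⟨⟨⟨D, V⟩, h⟩, rfl⟩ := Quotient.exists_rep L
  have hdeg : D.degree = r + 1 := h.degree_eq
  obtain ⟨x, hx⟩ := exists_sub_single_mem_principalDivisors (D := M - D)
    (by rw [Divisor.degree_sub]; omega)
  rw [sub_right_comm] at hx
  have hx' := (principalDivisors F K).neg_mem hx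
  rw [neg_sub] at hx'
  obtain ⟨f, hf⟩ := hx'
  have hV := h.seriesIso_map hf ((degree_sub_single hM x).trans hdeg.symm)
  set W := V.map (LinearMap.mulLeft F f)
  have := hV.finiteDimensional
  let b := Module.finBasisOfFinrankEq F W hV.finrank_eq
  have hspan : Submodule.span F (Set.range fun i => (b i : K)) = W := by
    have := congrArg (Submodule.map W.subtype) b.span_eq
    rwa [Submodule.map_span, ← Set.range_comp, Submodule.map_top, Submodule.range_subtype] at this
  have hz : IsExactSeries p q α α (M - Finsupp.single x 1)
      (Submodule.span F (Set.range fun i => (b i : K))) := by rwa [hspan]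
  exact ⟨⟨(x, fun i => (b i : K)), hz⟩,
    Quotient.sound ((seriesIso_iff hpq hα hα le_rfl hz h).2 hx)⟩

theorem exists_frame_of_mem_genericPoints (hpq : p ≠ q) (hα : Monotone α)
    (hM : M.degree = r + 2) {x : Point F K} (hx : x ∈ genericPoints p q α M) :
    ∃ z : Frames p q α α M, z.1.1 = x := by
  choose f hf g hg hli using fun i : Fin (r + 1) => exists_pencil
    (N := twist M p q (r - α i - (i : ℕ)) (α i + (i : ℕ))) (by rw [degree_twist]; omega)
  exact ⟨⟨(x, fun i => pencilMember (f i) (g i) x), isExactSeries_span hpq hα hα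
    (degree_sub_single hM x) Function.bijective_id fun i =>
      hasExactOrders_pencilMember hpq hM hx (hf i) (hg i) (hli i)⟩, rfl⟩

open scoped Topology in
/-- An open set that contains one generic series contains almost all series. -/
theorem eventually_exists_frame_mem (hpq : p ≠ q) (hα : Monotone α) (hM : M.degree = r + 2)
    {U : Set (GTilde p q α α)} (hU : IsOpen U) {z : Frames p q α α M}
    (hz : z.1.1 ∈ genericPoints p q α M) (hzU : z.toGTilde ∈ U) :
    ∀ᶠ x in Filter.cofinite, ∃ w : Frames p q α α M, w.1.1 = x ∧ w.toGTilde ∈ U := by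
  choose f hf g hg hli using fun i : Fin (r + 1) => exists_pencil
    (N := twist M p q (r - α i - (i : ℕ)) (α i + (i : ℕ))) (by rw [degree_twist]; omega)
  have hord : ∀ x ∈ genericPoints p q α M, ∀ i, HasExactOrders (M - Finsupp.single x 1) p q
      (r - α i - (i : ℕ)) (α i + (i : ℕ)) (pencilMember (f i) (g i) x) := fun x hx i =>
    hasExactOrders_pencilMember hpq hM hx (hf i) (hg i) (hli i)
  have hspan : ∀ x ∈ genericPoints p q α M, IsExactSeries p q α α (M - Finsupp.single x 1)
      (Submodule.span F (Set.range fun i => pencilMember (f i) (g i) x)) := fun x hx =>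
    isExactSeries_span hpq hα hα (degree_sub_single hM x) Function.bijective_id (hord x hx)
  obtain ⟨⟨x₀, v⟩, hv⟩ := z
  -- The given frame is an invertible matrix `A` applied to the pencil members at `x₀`. Keeping `A`
  -- fixed while `x` varies extends it to a family of frames through the given one.
  obtain ⟨A, B, hBA, rfl⟩ := exists_matrix_of_span_eq
    (linearIndependent_of_hasExactOrders hα (hord x₀ hz))
    (hv.eq hpq hα hα le_rfl (hspan x₀ hz))
  have hU' := isOpen_coinduced.1 (isOpen_iSup_iff.1 hU M)
  obtain ⟨O, hO, hOU⟩ := (isOpen_induced_iff (t := zariski F K r)).1 hU'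
  have hmemO : ∀ w : Frames p q α α M, w.1 ∈ O ↔ w.toGTilde ∈ U := fun w =>
    Set.ext_iff.1 hOU w
  have hreg : ∀ k, x₀.v (f k) ≤ 1 ∧ x₀.v (g k) ≤ 1 := fun k =>
    ⟨by simpa [(hz k).1] using mem_H0.1 (hf k) x₀, by simpa [(hz k).1] using mem_H0.1 (hg k) x₀⟩
  filter_upwards [eventually_mem_of_isOpen_zariski A (fun k => (hreg k).1) (fun k => (hreg k).2)
    hO ((hmemO _).2 hzU), Filter.eventually_cofinite.2 (finite_compl_genericPoints p q α M)]
    with x hx hxG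
  let w : Frames p q α α M := ⟨(x, fun j => ∑ k, A j k • pencilMember (f k) (g k) x), by
    rw [span_range_sum_smul hBA]
    exact hspan x hxG⟩
  exact ⟨w, rfl, (hmemO w).1 hx⟩

theorem topologicalKrullDim_gTilde (hpq : p ≠ q) (hα : Monotone α) :
    topologicalKrullDim (GTilde p q α α) = 1 := by
  set M : Divisor F K := Finsupp.single p (r + 2)
  have hM : M.degree = r + 2 := Divisor.degree_single p _
  choose φ hφ using exists_frame_eq (M := M) hpq hα hM
  -- `ψ` sends a series to the unique `x` with line bundle `O(M - x)`; it embeds the space in the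
  -- curve, with image containing the generic points.
  set ψ : GTilde p q α α → Point F K := fun L => (φ L).1.1
  have hψ : ∀ z : Frames p q α α M, ψ z.toGTilde = z.1.1 := fun z =>
    (toGTilde_eq_iff hpq hα _ z).1 (hφ _)
  have hinj : Function.Injective ψ := fun L L' h => by
    rw [← hφ L, ← hφ L']
    exact (toGTilde_eq_iff hpq hα _ _).2 h
  have hfin := finite_compl_genericPoints p q α M
  refine topologicalKrullDim_eq_one (isClosed_singleton_gTilde hpq hα)
    (G := ψ ⁻¹' genericPoints p q α M) ?_ (hfin.preimage hinj.injOn) ?_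
  · have := infinite_point F K
    refine Set.Infinite.of_image ψ ?_
    rw [Set.image_preimage_eq_of_subset]
    · exact hfin.infinite_compl.mono (by rw [compl_compl])
    · intro x hx
      obtain ⟨z, rfl⟩ := exists_frame_of_mem_genericPoints hpq hα hM hx
      exact ⟨z.toGTilde, hψ z⟩
  · rintro U hU ⟨L, hLU, hLG⟩
    have := eventually_exists_frame_mem hpq hα hM hU (z := φ L) hLG (by rwa [hφ])
    refine (Set.Finite.preimage hinj.injOn (Filter.eventually_cofinite.1 this)).subset
      fun L' hL' => ?_
    rintro ⟨w, hw, hwU⟩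
    have heq : w.toGTilde = L' := by
      rw [← hφ L']
      exact (toGTilde_eq_iff hpq hα _ _).2 hw
    exact hL' (heq ▸ hwU)

end Dimension
end
end TwiceMarked

theorem mainTheorem7 {F K : Type*} [Field F] [IsAlgClosed F] [Field K] [Algebra F K]
    (hE : TwiceMarked.IsCurve F K) (hgenus : TwiceMarked.HasGenus F K 1)
    (p q : TwiceMarked.Point F K) (hpq : p ≠ q)
    (r : ℕ) (α β : Fin (r + 1) → ℤ) (hα : Monotone α) (hβ : Monotone β) (hαβ : α ≤ β) :
    (α = β → topologicalKrullDim (TwiceMarked.GTilde p q α β) = 1) ∧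
    (α < β →
      ((∃ Λ : Set ℤ, TwiceMarked.IsProgression (TwiceMarked.torsionOrder p q) Λ ∧
          TwiceMarked.Linked Λ α β) →
        ∃ L : TwiceMarked.GTilde p q α β, ∀ L' : TwiceMarked.GTilde p q α β, L' = L) ∧
      ((¬ ∃ Λ : Set ℤ, TwiceMarked.IsProgression (TwiceMarked.torsionOrder p q) Λ ∧
          TwiceMarked.Linked Λ α β) →
        IsEmpty (TwiceMarked.GTilde p q α β))) := by
  have : TwiceMarked.GenusOne F K := ⟨hE, hgenus, ⟨p⟩⟩
  refine ⟨?_, fun hlt => ⟨TwiceMarked.existsUnique_gTilde hpq hα hβ hlt,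
    TwiceMarked.isEmpty_gTilde hpq hα hβ hlt⟩⟩
  rintro rfl
  exact TwiceMarked.topologicalKrullDim_gTilde hpq hα
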